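/- Let $d\ge 1$ be an integer and let $\mathbb{D}^d=\{z=(z^1,\dots,z^d)\in\mathbb{C}^d : |z^i|<1,\ i=1,\dots,d\}$. Let $H^2_d$ be the Hardy space of the polydisc, that is, the reproducing kernel Hilbert space on $\mathbb{D}^d$ with kernel $$s(z,w)=\prod_{i=1}^d\frac{1}{1-\overline{w^i}z^i},\qquad z,w\in\mathbb{D}^d,$$ and write $s_w=s(\cdot,w)\in H^2_d$. A sequence $Z=(z_n)_{n\in\mathbb{N}}$ in $\mathbb{D}^d$ is a *Carleson sequence* for $H^2_d$ if the measure $\mu_Z=\sum_{n}\|s_{z_n}\|^{-2}\,\delta_{z_n}$ is a Carleson measure for $H^2_d$, i.e. if there is a finite constant $C_Z$ with $\|f\|_{L^2(\mathbb{D}^d,\mu_Z)}\le C_Z\|f\|_{H^2_d}$ for all $f\in H^2_d$. Let $(r_n)_{n\in\mathbb{N}}$ be a deterministic sequence in $[0,1)^d$, let $(\theta_n)_{n\in\mathbb{N}}$ be i.i.d. random variables on a probability space $(\Omega,\mathcal{A},\mathbb{P})$, uniformly distributed in the torus $\mathbb{T}^d=(\mathbb{R}/\mathbb{Z})^d$,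 and let $\Lambda=(\lambda_n)_{n\in\mathbb{N}}$ be the random sequence $$\lambda_n=(r_n^1e^{2\pi i\theta_n^1},\dots,r_n^de^{2\pi i\theta_n^d}).$$ For $m=(m_1,\dots,m_d)\in\mathbb{N}^d$ (with $0\in\mathbb{N}$) put $|m|=m_1+\dots+m_d$, let $A_m$ be the set of $z\in\mathbb{D}^d$ such that, for every $i$, $2^{-(m_i+1)}\le 1-|z^i|$ and, if $m_i\ge 1$, $1-|z^i|<2^{-m_i}$ (so that the sets $A_m$ partition $\mathbb{D}^d$), and let $N_m=\#\{n\in\mathbb{N} : \lambda_n\in A_m\}\in\mathbb{N}\cup\{\infty\}$, which depends only on the radii $(r_n)$. Then $\Lambda$ is almost surely a Carleson sequence for $H^2_d$ if there exist $\varepsilon,C>0$ such that $N_m\le C\,2^{(1-\varepsilon)|m|}$ for all $m\in\mathbb{N}^d$; otherwise $\Lambda$ is almost surely not a Carleson sequence for $H^2_d$. -/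

import Mathlib

open MeasureTheory ProbabilityTheory
open scoped ENNReal NNReal ComplexConjugate

noncomputable section

namespace PolydiscCarleson

/-! ### Carleson measures and Carleson sequences in a reproducing kernel Hilbert space -/

section Carleson

variable {X : Type*} [MeasurableSpace X]
variable (H : Type*) [NormedAddCommGroup H] [InnerProductSpace ℂ H] [RKHS ℂ H X ℂ]

/-- `μ` is a Carleson measure for the reproducing kernel Hilbert space `H` of functions on `X`:
`H` is contained in `L²(X, μ)`, and `‖f‖_{L²(X, μ)} ≤ C ‖f‖_H` for some finite constant `C`. -/
def IsCarlesonMeasure (μ : Measure X) : Prop :=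
  ∃ C : ℝ≥0, ∀ f : H, MemLp (f : X → ℂ) 2 μ ∧ eLpNorm (f : X → ℂ) 2 μ ≤ C * ‖f‖ₑ

variable [CompleteSpace H]

/-- The kernel function `k_z` at the point `z`, the element of `H` with `⟪k_z, f⟫ = f z`. -/
def kernelAt (z : X) : H := RKHS.kerFun H z 1

/-- The measure `μ_Z = ∑ₙ ‖k_{zₙ}‖⁻² δ_{zₙ}`. -/
def sequenceMeasure (Z : ℕ → X) : Measure X :=
  Measure.sum fun n => ((‖kernelAt H (Z n)‖ₑ ^ 2)⁻¹) • Measure.dirac (Z n)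

/-- `Z` is a Carleson sequence for `H` if `μ_Z` is a Carleson measure for `H`. -/
def IsCarlesonSequence (Z : ℕ → X) : Prop :=
  IsCarlesonMeasure H (sequenceMeasure H Z)

end Carleson

/-! ### The Hardy space of the polydisc -/

/-- The open unit polydisc `𝔻^d`. -/
abbrev Polydisc (d : ℕ) : Type := {z : Fin d → ℂ // ∀ i, ‖z i‖ < 1}

/-- The Szegő kernel `s(z, w) = ∏ᵢ 1 / (1 - conj(wᵢ) zᵢ)`. -/
def szego {d : ℕ} (z w : Polydisc d) : ℂ := ∏ i, 1 / (1 - conj (w.1 i) * z.1 i)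

/-- The Szegő kernel as an operator-valued kernel: `s(z, w)` acts on `ℂ` by multiplication. -/
def szegoKernel (d : ℕ) : Matrix (Polydisc d) (Polydisc d) (ℂ →L[ℂ] ℂ) :=
  Matrix.of fun z w => szego z w • ContinuousLinearMap.id ℂ ℂ

theorem szego_conj {d : ℕ} (z w : Polydisc d) : conj (szego z w) = szego w z := by
  simp [szego, map_prod, mul_comm]

/-- Positivity of products of one-variable Szegő kernels. -/
theorem szego_pos_aux {d : ℕ} (F : Finset (Polydisc d)) (S : Finset (Fin d)) :
    ∀ c : Polydisc d → ℂ, 0 ≤ (∑ w ∈ F, ∑ z ∈ F,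
      conj (c w) * c z * ∏ i ∈ S, 1 / (1 - conj (z.1 i) * w.1 i)).re := by
  induction S using Finset.induction_on with
  | empty =>
    intro c
    have h : (∑ w ∈ F, ∑ z ∈ F, conj (c w) * c z *
        ∏ i ∈ (∅ : Finset (Fin d)), 1 / (1 - conj (z.1 i) * w.1 i))
        = conj (∑ w ∈ F, c w) * ∑ z ∈ F, c z := by
      simp [map_sum, Finset.sum_mul_sum]
    rw [h, ← Complex.normSq_eq_conj_mul_self, Complex.ofReal_re]
    exact Complex.normSq_nonneg _
  | insert a S ha ih =>
    intro c
    have key : HasSum (fun k : ℕ => ∑ w ∈ F, ∑ z ∈ F,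
        conj (c w * conj (w.1 a) ^ k) * (c z * conj (z.1 a) ^ k) *
          ∏ i ∈ S, 1 / (1 - conj (z.1 i) * w.1 i))
        (∑ w ∈ F, ∑ z ∈ F, conj (c w) * c z *
          ∏ i ∈ insert a S, 1 / (1 - conj (z.1 i) * w.1 i)) := by
      refine hasSum_sum fun w _ => hasSum_sum fun z _ => ?_
      have hlt : ‖conj (z.1 a) * w.1 a‖ < 1 := by
        rw [norm_mul, RCLike.norm_conj]
        nlinarith [z.2 a, w.2 a, norm_nonneg (z.1 a), norm_nonneg (w.1 a)]
      have hg := (hasSum_geometric_of_norm_lt_one hlt).mul_left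
        (conj (c w) * c z * ∏ i ∈ S, 1 / (1 - conj (z.1 i) * w.1 i))
      rw [Finset.prod_insert ha]
      have e1 : (fun k : ℕ => conj (c w * conj (w.1 a) ^ k) * (c z * conj (z.1 a) ^ k) *
          ∏ i ∈ S, 1 / (1 - conj (z.1 i) * w.1 i)) = fun k : ℕ =>
          (conj (c w) * c z * ∏ i ∈ S, 1 / (1 - conj (z.1 i) * w.1 i)) *
            (conj (z.1 a) * w.1 a) ^ k := by
        funext k
        simp only [map_mul, map_pow, Complex.conj_conj, mul_pow]
        ring
      have e2 : conj (c w) * c z * (1 / (1 - conj (z.1 a) * w.1 a) *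
          ∏ i ∈ S, 1 / (1 - conj (z.1 i) * w.1 i)) =
          (conj (c w) * c z * ∏ i ∈ S, 1 / (1 - conj (z.1 i) * w.1 i)) *
            (1 - conj (z.1 a) * w.1 a)⁻¹ := by
        rw [one_div (1 - conj (z.1 a) * w.1 a)]
        ring
      rw [e1, e2]
      exact hg
    have hre := Complex.hasSum_re key
    exact hre.nonneg fun k => ih fun z => c z * conj (z.1 a) ^ k

instance szegoKernel_posSemidef (d : ℕ) : Fact (szegoKernel d).PosSemidef := by
  constructor
  have htfae := RKHS.posSemidef_tfae (K := szegoKernel d)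
  have hiff := htfae.out 0 2
  refine hiff.mpr ⟨?_, fun vv => ?_⟩
  · ext z w
    have hid : star (ContinuousLinearMap.id ℂ ℂ) = ContinuousLinearMap.id ℂ ℂ :=
      star_one (ℂ →L[ℂ] ℂ)
    simp [szegoKernel, Matrix.conjTranspose_apply, szego_conj, hid]
  · have h := szego_pos_aux vv.support Finset.univ fun z => vv z
    simp only [Finsupp.sum, szegoKernel, szego, Matrix.of_apply]
    convert h using 1
    refine congrArg Complex.re (Finset.sum_congr rfl fun w _ => Finset.sum_congr rfl fun z _ => ?_)
    simp only [RCLike.inner_apply, smul_apply, ContinuousLinearMap.id_apply, smul_eq_mul,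
      map_mul, map_prod, map_div₀, map_sub, map_one, Complex.conj_conj]
    simp only [mul_comm (conj (z.1 _)) (w.1 _)]
    ring

/-- The Hardy space `H²_d`: the reproducing kernel Hilbert space on `𝔻^d` with the Szegő kernel. -/
abbrev HardySpace (d : ℕ) : Type := RKHS.OfKernel (szegoKernel d)

/-! ### Random sequences with prescribed radii -/

/-- The point `(r¹ e^{2πiθ¹}, …, r^d e^{2πiθ^d})` of the polydisc. -/
def polarPoint {d : ℕ} (r : Fin d → Set.Ico (0 : ℝ) 1) (θ : Fin d → UnitAddCircle) :
    Polydisc d :=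
  ⟨fun i => ((r i : ℝ) : ℂ) * ((θ i).toCircle : ℂ), fun i => by
    rw [norm_mul, Circle.norm_coe, mul_one, Complex.norm_real, Real.norm_of_nonneg (r i).2.1]
    exact (r i).2.2⟩

/-- The `k`-th dyadic interval of radii: `2^{-(k+1)} ≤ 1 - ρ < 2^{-k}`, where for `k = 0` the
second inequality is dropped, so that `ρ = 0` is included and these intervals partition
`[0, 1)`. -/
def dyadicRadii (k : ℕ) : Set ℝ :=
  {ρ | (2 : ℝ)⁻¹ ^ (k + 1) ≤ 1 - ρ ∧ (k = 0 ∨ 1 - ρ < (2 : ℝ)⁻¹ ^ k)}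

/-- The dyadic region `A_m` of the polydisc. -/
def dyadicRegion {d : ℕ} (m : Fin d → ℕ) : Set (Polydisc d) :=
  {z | ∀ i, ‖z.1 i‖ ∈ dyadicRadii (m i)}

/-- The number of terms of the sequence `Z` (with multiplicity, possibly infinite) in `A_m`. -/
def regionCount {d : ℕ} (Z : ℕ → Polydisc d) (m : Fin d → ℕ) : ℕ∞ :=
  {n | Z n ∈ dyadicRegion m}.encard

/-- The number `N_m` of terms in `A_m` of any sequence with radii `r`. -/
def radiiCount {d : ℕ} (r : ℕ → Fin d → Set.Ico (0 : ℝ) 1) (m : Fin d → ℕ) : ℕ∞ :=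
  {n | ∀ i, (r n i : ℝ) ∈ dyadicRadii (m i)}.encard

theorem regionCount_polarPoint {d : ℕ} (r : ℕ → Fin d → Set.Ico (0 : ℝ) 1)
    (θ : ℕ → Fin d → UnitAddCircle) (m : Fin d → ℕ) :
    regionCount (fun n => polarPoint (r n) (θ n)) m = radiiCount r m := by
  have h : ∀ n i, ‖(polarPoint (r n) (θ n)).1 i‖ = r n i := fun n i => by
    simp only [polarPoint]
    rw [norm_mul, Circle.norm_coe, mul_one, Complex.norm_real, Real.norm_of_nonneg (r n i).2.1]
  simp only [regionCount, radiiCount, dyadicRegion, Set.mem_ofPred_eq, h]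

/-- The uniform distribution on the torus `𝕋^d`. -/
def torusMeasure (d : ℕ) : Measure (Fin d → UnitAddCircle) :=
  Measure.pi fun _ => AddCircle.haarAddCircle

end PolydiscCarleson

end

/-!
Carleson sequences for a reproducing kernel Hilbert space are those for which the Gram matrix `G`
of the normalized kernel functions is bounded on `ℓ²`. For the Szegő kernel, `|G|` at two points
of the regions `A_m` and `A_{m'}` is a product of factors
`2^{-(m i + m' i)/2} / |1 - conj(w i) z i|`, which depend, up to constants, only on the distance of
the angles. Only two consequences of the boundedness of `G` are needed, one in each direction.

*Sufficiency.* If `N_m ≤ C 2^{(1-ε)|m|}`, then almost surely every box of side lengths `2^{-l i}`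
with `l ≤ m` contains at most `K (1 + 2^{(1-ε/2)|m| - |l|})` of the angles of `A_m`
(`ae_exists_box_count_le`): the count is binomial with mean at most a constant times `2^{-ε|m|/2}`
times the second term, so the probability of exceeding the bound is at most `4^{-|m|}` for large
`K`, which survives the union over all boxes and allows the Borel–Cantelli lemma. Given these
counts, Schur's test with the weights `2^{-a|m|}`, `a = 1/2 - ε/4`, applies to the absolute values
of the entries of `G` (`isCarlesonSequence_of_box_counts`): the constant term of the count yields
row sums that decay geometrically in `|m i - m' i|`, and the mean term yields row sums that decay
geometrically in `m'`. In the proofs, `q = 2^{-ε/4}`.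

*Necessity.* If no such bound holds, then for each `j` either some `N_m` is infinite, or there are
arbitrarily large `M = 2^{|m|}` with `N_m ≥ M^{1 - 1/(2j)}`. The torus is covered by `M` boxes of
measure `1 / M`; by a comparison with independent Poisson counts, carried out by bounding the
number of maps with small fibres by a coefficient of a power of a truncated exponential series
(`card_smallFibreMaps_mul_pow_le`), the probability that no box receives `j` points is `O(1/M)`.
Hence there are almost surely clusters of arbitrarily many points (`ae_exists_cluster`). The
entries of `G` within a cluster are at least `18^{-d}`, so that the rows of `G` are unbounded in
`ℓ²` and the embedding inequality fails on kernel functions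
(`not_isCarlesonSequence_of_clusters`).
-/

namespace PolydiscCarleson

/-! ### Carleson sequences and the Gram matrix of the normalized kernel functions -/

section Hilbert

variable {X : Type*}
variable {H : Type*} [NormedAddCommGroup H] [InnerProductSpace ℂ H] [RKHS ℂ H X ℂ]
  [CompleteSpace H]

theorem inner_kernelAt (z : X) (f : H) : inner ℂ (kernelAt H z) f = f z := by
  simp [kernelAt]

/-- The modulus of the inner product of the normalized kernel functions at `z` and `w`. -/
noncomputable def normalizedGram (H : Type*) [NormedAddCommGroup H] [InnerProductSpace ℂ H]
    [RKHS ℂ H X ℂ] [CompleteSpace H] (z w : X) : ℝ :=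
  ‖(inner ℂ (kernelAt H z) (kernelAt H w) : ℂ)‖ / (‖kernelAt H z‖ * ‖kernelAt H w‖)

theorem normalizedGram_comm (z w : X) : normalizedGram H z w = normalizedGram H w z := by
  rw [normalizedGram, normalizedGram, norm_inner_symm, mul_comm]

variable [MeasurableSpace X] [MeasurableSingletonClass X]

theorem lintegral_sequenceMeasure (Z : ℕ → X) (g : X → ℝ≥0∞) :
    ∫⁻ x, g x ∂(sequenceMeasure H Z) = ∑' n, (‖kernelAt H (Z n)‖ₑ ^ 2)⁻¹ * g (Z n) := by
  simp [sequenceMeasure, lintegral_sum_measure, lintegral_smul_measure]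

theorem aestronglyMeasurable_sequenceMeasure (Z : ℕ → X) (f : X → ℂ) :
    AEStronglyMeasurable f (sequenceMeasure H Z) :=
  AEStronglyMeasurable.sum_measure fun _ => aestronglyMeasurable_dirac.smul_measure _

theorem eLpNorm_sequenceMeasure_sq (Z : ℕ → X) (f : X → ℂ)
    (hne : ∀ n, kernelAt H (Z n) ≠ 0) :
    eLpNorm f 2 (sequenceMeasure H Z) ^ 2 =
      ∑' n, ENNReal.ofReal ((‖f (Z n)‖ / ‖kernelAt H (Z n)‖) ^ 2) := by
  rw [eLpNorm_eq_lintegral_rpow_enorm_toReal (by norm_num) (by norm_num)]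
  rw [← ENNReal.rpow_natCast, ← ENNReal.rpow_mul]
  simp only [ENNReal.toReal_ofNat, Nat.cast_ofNat, one_div, ne_eq, OfNat.ofNat_ne_zero,
    not_false_eq_true, inv_mul_cancel₀, ENNReal.rpow_one]
  rw [lintegral_sequenceMeasure]
  refine tsum_congr fun n => ?_
  have h0 : 0 < ‖kernelAt H (Z n)‖ := norm_pos_iff.2 (hne n)
  rw [div_pow, ENNReal.ofReal_div_of_pos (by positivity), ENNReal.ofReal_pow (norm_nonneg _),
    ENNReal.ofReal_pow (norm_nonneg _), ofReal_norm, ofReal_norm, ENNReal.div_eq_inv_mul]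
  norm_num

/-- A sequence is Carleson if and only if the embedding inequality holds, with one constant, for
all its finite subfamilies. -/
theorem isCarlesonSequence_iff (Z : ℕ → X) (hne : ∀ n, kernelAt H (Z n) ≠ 0) :
    IsCarlesonSequence H Z ↔ ∃ B : ℝ, 0 ≤ B ∧ ∀ (f : H) (J : Finset ℕ),
      ∑ n ∈ J, (‖f (Z n)‖ / ‖kernelAt H (Z n)‖) ^ 2 ≤ B * ‖f‖ ^ 2 := by
  constructor
  · rintro ⟨C, hC⟩
    refine ⟨C ^ 2, by positivity, fun f J => ?_⟩
    have h1 : eLpNorm f 2 (sequenceMeasure H Z) ^ 2 ≤ (C * ‖f‖ₑ) ^ 2 := by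
      gcongr
      exact (hC f).2
    rw [eLpNorm_sequenceMeasure_sq Z f hne] at h1
    have h2 := (ENNReal.sum_le_tsum J).trans h1
    rw [← ENNReal.ofReal_sum_of_nonneg (fun _ _ => by positivity)] at h2
    have h3 : ((C : ℝ≥0∞) * ‖f‖ₑ) ^ 2 = ENNReal.ofReal ((C : ℝ) ^ 2 * ‖f‖ ^ 2) := by
      rw [← mul_pow, ENNReal.ofReal_pow (by positivity), ENNReal.ofReal_mul (by positivity),
        ofReal_norm, ENNReal.ofReal_coe_nnreal]
    rw [h3] at h2
    exact (ENNReal.ofReal_le_ofReal_iff (by positivity)).1 h2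
  · rintro ⟨B, hB, h⟩
    have key : ∀ f : H, eLpNorm (f : X → ℂ) 2 (sequenceMeasure H Z) ≤
        (Real.toNNReal (√B) : ℝ≥0∞) * ‖f‖ₑ := by
      intro f
      have h1 : eLpNorm f 2 (sequenceMeasure H Z) ^ 2 ≤
          ((Real.toNNReal (√B) : ℝ≥0∞) * ‖f‖ₑ) ^ 2 := by
        have h3 : ((Real.toNNReal (√B) : ℝ≥0∞) * ‖f‖ₑ) ^ 2 = ENNReal.ofReal (B * ‖f‖ ^ 2) := by
          rw [mul_pow, ENNReal.ofReal_mul hB, ENNReal.ofReal_pow (by positivity), ofReal_norm,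
            ← ENNReal.ofReal, ← ENNReal.ofReal_pow (by positivity), Real.sq_sqrt hB]
        rw [eLpNorm_sequenceMeasure_sq Z f hne, h3]
        refine ENNReal.summable.tsum_le_of_sum_le fun J => ?_
        rw [← ENNReal.ofReal_sum_of_nonneg (fun _ _ => by positivity)]
        exact ENNReal.ofReal_le_ofReal (h f J)
      exact (ENNReal.pow_le_pow_left_iff two_ne_zero).1 h1
    exact ⟨Real.toNNReal (√B), fun f => ⟨⟨aestronglyMeasurable_sequenceMeasure Z f,
      (key f).trans_lt (ENNReal.mul_lt_top ENNReal.coe_lt_top enorm_lt_top)⟩, key f⟩⟩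

/-- The embedding inequality tested on the kernel functions bounds the rows of the Gram matrix
in `ℓ²`. -/
theorem IsCarlesonSequence.sum_normalizedGram_sq_le {Z : ℕ → X}
    (hne : ∀ n, kernelAt H (Z n) ≠ 0) (h : IsCarlesonSequence H Z) :
    ∃ B : ℝ, ∀ n (J : Finset ℕ), ∑ j ∈ J, normalizedGram H (Z n) (Z j) ^ 2 ≤ B := by
  obtain ⟨B, -, hB⟩ := (isCarlesonSequence_iff Z hne).1 h
  refine ⟨B, fun n J => ?_⟩
  have h0 : 0 < ‖kernelAt H (Z n)‖ := norm_pos_iff.2 (hne n)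
  have h1 := hB (kernelAt H (Z n)) J
  rw [← div_le_iff₀ (by positivity), Finset.sum_div] at h1
  refine le_trans (le_of_eq (Finset.sum_congr rfl fun j _ => ?_)) h1
  rw [normalizedGram, ← inner_kernelAt, norm_inner_symm, div_pow, div_pow, mul_pow, div_div,
    mul_comm]

end Hilbert

/-- **Schur's test** for a finite symmetric matrix with nonnegative entries. -/
theorem schur_test {ι : Type*} (J : Finset ι) (g : ι → ι → ℝ) (hg : ∀ i j, 0 ≤ g i j)
    (hsymm : ∀ i j, g i j = g j i) (w : ι → ℝ) (hw : ∀ i, 0 < w i) (B : ℝ)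
    (hB : ∀ i ∈ J, ∑ j ∈ J, g i j * w j ≤ B * w i) (a : ι → ℝ) :
    ∑ i ∈ J, ∑ j ∈ J, g i j * (a i * a j) ≤ B * ∑ i ∈ J, a i ^ 2 := by
  have h1 : ∀ i j, g i j * (a i * a j) ≤
      (g i j * w j * (a i ^ 2 / w i)) / 2 + (g j i * w i * (a j ^ 2 / w j)) / 2 := by
    intro i j
    have hi := hw i
    have hj := hw j
    have e : (g i j * w j * (a i ^ 2 / w i)) / 2 + (g j i * w i * (a j ^ 2 / w j)) / 2
        - g i j * (a i * a j) = g i j * (a i * w j - a j * w i) ^ 2 / (2 * w i * w j) := by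
      rw [hsymm j i]
      field_simp
      ring
    have : 0 ≤ g i j * (a i * w j - a j * w i) ^ 2 / (2 * w i * w j) := by
      have := hg i j
      positivity
    linarith
  have h2 : ∑ i ∈ J, ∑ j ∈ J, (g i j * w j * (a i ^ 2 / w i)) / 2 ≤ (B * ∑ i ∈ J, a i ^ 2) / 2 := by
    rw [Finset.mul_sum, Finset.sum_div]
    refine Finset.sum_le_sum fun i hi => ?_
    rw [← Finset.sum_div, ← Finset.sum_mul]
    have hwi := hw i
    have := mul_le_mul_of_nonneg_right (hB i hi) (show 0 ≤ a i ^ 2 / w i by positivity)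
    have e : B * w i * (a i ^ 2 / w i) = B * a i ^ 2 := by field_simp
    linarith
  calc _ ≤ ∑ i ∈ J, ∑ j ∈ J, ((g i j * w j * (a i ^ 2 / w i)) / 2 +
        (g j i * w i * (a j ^ 2 / w j)) / 2) :=
        Finset.sum_le_sum fun i _ => Finset.sum_le_sum fun j _ => h1 i j
    _ = ∑ i ∈ J, ∑ j ∈ J, (g i j * w j * (a i ^ 2 / w i)) / 2 +
        ∑ i ∈ J, ∑ j ∈ J, (g i j * w j * (a i ^ 2 / w i)) / 2 := by
        simp only [Finset.sum_add_distrib]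
        congr 1
        exact Finset.sum_comm
    _ ≤ _ := by linarith

/-- Schur's test for the Gram matrix of the normalized kernel functions gives the Carleson
embedding, by duality. -/
theorem isCarlesonSequence_of_schur {X : Type*} [MeasurableSpace X] [MeasurableSingletonClass X]
    {H : Type*} [NormedAddCommGroup H] [InnerProductSpace ℂ H] [RKHS ℂ H X ℂ] [CompleteSpace H]
    {Z : ℕ → X} (hne : ∀ n, kernelAt H (Z n) ≠ 0) (w : ℕ → ℝ) (hw : ∀ n, 0 < w n) (B : ℝ)
    (hB : ∀ n (J : Finset ℕ), ∑ j ∈ J, normalizedGram H (Z n) (Z j) * w j ≤ B * w n) :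
    IsCarlesonSequence H Z := by
  have hB0 : 0 ≤ B := by
    have := hB 0 ∅
    simp only [Finset.sum_empty] at this
    exact nonneg_of_mul_nonneg_left this (hw 0)
  refine (isCarlesonSequence_iff Z hne).2 ⟨B, hB0, fun f J => ?_⟩
  set S := ∑ n ∈ J, (‖f (Z n)‖ / ‖kernelAt H (Z n)‖) ^ 2 with hS
  have hS0 : 0 ≤ S := Finset.sum_nonneg fun _ _ => by positivity
  have hpos : ∀ n, 0 < ‖kernelAt H (Z n)‖ := fun n => norm_pos_iff.2 (hne n)
  let c : ℕ → ℂ := fun n => f (Z n) / (‖kernelAt H (Z n)‖ : ℂ) ^ 2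
  let v : H := ∑ n ∈ J, c n • kernelAt H (Z n)
  have h1 : (inner ℂ v f : ℂ) = (S : ℂ) := by
    simp only [v, sum_inner, inner_smul_left, inner_kernelAt, hS, c, Complex.ofReal_sum]
    refine Finset.sum_congr rfl fun n _ => ?_
    rw [map_div₀, map_pow, Complex.conj_ofReal]
    push_cast
    rw [div_pow, ← Complex.conj_mul']
    ring
  have h2 : ‖v‖ ^ 2 ≤ B * S := by
    have e1 : (‖v‖ : ℝ) ^ 2 ≤ ∑ i ∈ J, ∑ j ∈ J, normalizedGram H (Z i) (Z j) *
        ((‖f (Z i)‖ / ‖kernelAt H (Z i)‖) * (‖f (Z j)‖ / ‖kernelAt H (Z j)‖)) := by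
      have e2 : ((‖v‖ : ℝ) : ℂ) ^ 2 = ∑ i ∈ J, ∑ j ∈ J,
          conj (c i) * (c j * inner ℂ (kernelAt H (Z i)) (kernelAt H (Z j))) := by
        have := inner_self_eq_norm_sq_to_K (𝕜 := ℂ) v
        rw [show ((‖v‖ : ℝ) : ℂ) ^ 2 = inner ℂ v v from this.symm]
        simp only [v, sum_inner, inner_sum, inner_smul_left, inner_smul_right, Finset.mul_sum]
        rw [Finset.sum_comm]
        exact Finset.sum_congr rfl fun i _ => Finset.sum_congr rfl fun j _ => by ring
      have e3 : ‖v‖ ^ 2 = ‖((‖v‖ : ℝ) : ℂ) ^ 2‖ := by simp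
      rw [e3, e2]
      refine (norm_sum_le _ _).trans (Finset.sum_le_sum fun i _ => ?_)
      refine (norm_sum_le _ _).trans (Finset.sum_le_sum fun j _ => le_of_eq ?_)
      have hi := hpos i
      have hj := hpos j
      simp only [norm_mul, RCLike.norm_conj, c, norm_div, norm_pow, Complex.norm_real,
        norm_norm, normalizedGram]
      field_simp
    refine e1.trans (schur_test J (fun i j => normalizedGram H (Z i) (Z j)) ?_ ?_ w hw B
      (fun i _ => hB i J) _)
    · intro i j
      unfold normalizedGram
      positivity
    · exact fun i j => normalizedGram_comm _ _
  have h3 : S ≤ ‖v‖ * ‖f‖ := by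
    have := norm_inner_le_norm (𝕜 := ℂ) v f
    rwa [h1, Complex.norm_real, Real.norm_of_nonneg hS0] at this
  rcases hS0.eq_or_lt with h0 | h0
  · rw [← h0]
    positivity
  · have h4 : S * S ≤ (B * ‖f‖ ^ 2) * S := by
      calc S * S ≤ (‖v‖ * ‖f‖) * (‖v‖ * ‖f‖) := by gcongr
        _ = ‖v‖ ^ 2 * ‖f‖ ^ 2 := by ring
        _ ≤ B * S * ‖f‖ ^ 2 := by gcongr
        _ = _ := by ring
    exact le_of_mul_le_mul_right h4 h0

/-! ### The normalized Szegő kernel -/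

section Szego

variable {d : ℕ}

theorem kernelAt_apply (z w : Polydisc d) : kernelAt (HardySpace d) w z = szego z w := by
  rw [kernelAt, RKHS.kerFun_apply, RKHS.OfKernel.kernel_ofKernel]
  simp [szegoKernel]

theorem one_sub_norm_sq_pos (z : Polydisc d) (i : Fin d) : 0 < 1 - ‖z.1 i‖ ^ 2 := by
  have := z.2 i
  nlinarith [norm_nonneg (z.1 i)]

theorem norm_kernelAt (z : Polydisc d) :
    ‖kernelAt (HardySpace d) z‖ = ∏ i, (√(1 - ‖z.1 i‖ ^ 2))⁻¹ := by
  have h := inner_self_eq_norm_sq_to_K (𝕜 := ℂ) (kernelAt (HardySpace d) z)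
  rw [inner_kernelAt, kernelAt_apply] at h
  have h2 : szego z z = (((∏ i, (√(1 - ‖z.1 i‖ ^ 2))⁻¹) ^ 2 : ℝ) : ℂ) := by
    rw [szego, ← Finset.prod_pow, Complex.ofReal_prod]
    refine Finset.prod_congr rfl fun i _ => ?_
    rw [inv_pow, Real.sq_sqrt (one_sub_norm_sq_pos z i).le, Complex.conj_mul']
    push_cast
    rw [one_div]
  rw [h2] at h
  have h3 : (∏ i, (√(1 - ‖z.1 i‖ ^ 2))⁻¹) ^ 2 = ‖kernelAt (HardySpace d) z‖ ^ 2 := by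
    exact Complex.ofReal_injective (by simpa using h)
  exact (pow_left_inj₀ (norm_nonneg _) (Finset.prod_nonneg fun _ _ => by positivity)
    two_ne_zero).1 h3.symm

theorem kernelAt_ne_zero (z : Polydisc d) : kernelAt (HardySpace d) z ≠ 0 := by
  rw [← norm_pos_iff, norm_kernelAt]
  exact Finset.prod_pos fun i _ => inv_pos.2 (Real.sqrt_pos.2 (one_sub_norm_sq_pos z i))

theorem normalizedGram_eq (z w : Polydisc d) :
    normalizedGram (HardySpace d) z w =
      ∏ i, √(1 - ‖z.1 i‖ ^ 2) * √(1 - ‖w.1 i‖ ^ 2) / ‖1 - conj (w.1 i) * z.1 i‖ := by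
  rw [normalizedGram, inner_kernelAt, kernelAt_apply, norm_kernelAt, norm_kernelAt, szego,
    norm_prod, ← Finset.prod_mul_distrib, ← Finset.prod_div_distrib]
  refine Finset.prod_congr rfl fun i _ => ?_
  rw [norm_div, norm_one, div_div, ← mul_inv, ← div_eq_mul_inv, one_div_div]

end Szego

/-! ### Size of the normalized Szegő kernel in polar coordinates -/

section Geometry

theorem norm_unitAddCircle_le_half (t : UnitAddCircle) : ‖t‖ ≤ 1 / 2 := by
  simpa using AddCircle.norm_le_half_period (1 : ℝ) (x := t) one_ne_zero

theorem norm_toCircle_sub_one_eq (t : UnitAddCircle) :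
    ‖(t.toCircle : ℂ) - 1‖ = 2 * Real.sin (Real.pi * ‖t‖) := by
  obtain ⟨x, rfl⟩ := QuotientAddGroup.mk_surjective t
  change ‖(AddCircle.toCircle (x : UnitAddCircle) : ℂ) - 1‖ =
    2 * Real.sin (Real.pi * ‖(x : UnitAddCircle)‖)
  have e : (x : UnitAddCircle) = ((x - round x : ℝ) : UnitAddCircle) := by
    rw [AddCircle.coe_sub, eq_comm, sub_eq_self, AddCircle.coe_eq_zero_iff]
    exact ⟨round x, by simp⟩
  have hx := abs_sub_round x
  have hn : ‖(x : UnitAddCircle)‖ = |x - round x| := UnitAddCircle.norm_eq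
  rw [hn, e]
  generalize x - round x = y at hx
  rw [AddCircle.toCircle_apply_mk, Circle.coe_exp,
    show ((2 * Real.pi / 1 * y : ℝ) : ℂ) * Complex.I = Complex.I * ((2 * Real.pi * y : ℝ) : ℂ) by
      push_cast; ring, Complex.norm_exp_I_mul_ofReal_sub_one, Real.norm_eq_abs, abs_mul,
      abs_two, show 2 * Real.pi * y / 2 = Real.pi * y by ring]
  congr 1
  have h1 : 0 ≤ Real.sin (Real.pi * |y|) := Real.sin_nonneg_of_nonneg_of_le_pi
    (by positivity) (by nlinarith [Real.pi_pos])
  rcases abs_cases y with ⟨h, -⟩ | ⟨h, -⟩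
  · rw [h] at h1 ⊢
    exact abs_of_nonneg h1
  · rw [h, mul_neg, Real.sin_neg] at h1 ⊢
    exact abs_of_nonpos (by linarith)

theorem two_mul_norm_le_norm_toCircle_sub_one (t : UnitAddCircle) :
    2 * ‖t‖ ≤ ‖(t.toCircle : ℂ) - 1‖ := by
  rw [norm_toCircle_sub_one_eq]
  have h := norm_unitAddCircle_le_half t
  have h0 := norm_nonneg t
  have := Real.mul_le_sin (x := Real.pi * ‖t‖) (by positivity) (by nlinarith [Real.pi_pos])
  have e : 2 / Real.pi * (Real.pi * ‖t‖) = 2 * ‖t‖ := by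
    field_simp
  linarith

theorem norm_toCircle_sub_one_le (t : UnitAddCircle) :
    ‖(t.toCircle : ℂ) - 1‖ ≤ 7 * ‖t‖ := by
  rw [norm_toCircle_sub_one_eq]
  have h0 := norm_nonneg t
  have := Real.sin_le (x := Real.pi * ‖t‖) (by positivity)
  nlinarith [Real.pi_lt_d2]

theorem one_sub_le_norm_one_sub_mul_toCircle {a : ℝ} (ha : 0 ≤ a) (t : UnitAddCircle) :
    1 - a ≤ ‖1 - (a : ℂ) * (t.toCircle : ℂ)‖ := by
  have := norm_sub_norm_le (1 : ℂ) ((a : ℂ) * (t.toCircle : ℂ))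
  rwa [norm_one, norm_mul, Circle.norm_coe, mul_one, Complex.norm_real,
    Real.norm_of_nonneg ha] at this

theorem norm_le_norm_one_sub_mul_toCircle {a : ℝ} (ha : 0 ≤ a) (ha1 : a ≤ 1)
    (t : UnitAddCircle) : ‖t‖ ≤ ‖1 - (a : ℂ) * (t.toCircle : ℂ)‖ := by
  have h1 := one_sub_le_norm_one_sub_mul_toCircle ha t
  have h2 := two_mul_norm_le_norm_toCircle_sub_one t
  have h3 : ‖(t.toCircle : ℂ) - 1‖ ≤
      ‖((1 - a : ℝ) : ℂ) * (t.toCircle : ℂ)‖ + ‖1 - (a : ℂ) * (t.toCircle : ℂ)‖ := by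
    refine le_trans (le_of_eq ?_) (norm_sub_le _ _)
    congr 1
    push_cast
    ring
  have h4 : ‖((1 - a : ℝ) : ℂ) * (t.toCircle : ℂ)‖ = 1 - a := by
    rw [norm_mul, Circle.norm_coe, mul_one, Complex.norm_real, Real.norm_of_nonneg (by linarith)]
  linarith

theorem norm_one_sub_mul_toCircle_le {a : ℝ} (ha : 0 ≤ a) (ha1 : a ≤ 1) (t : UnitAddCircle) :
    ‖1 - (a : ℂ) * (t.toCircle : ℂ)‖ ≤ (1 - a) + 7 * ‖t‖ := by
  have h2 := norm_toCircle_sub_one_le t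
  have h3 : ‖1 - (a : ℂ) * (t.toCircle : ℂ)‖ ≤
      ‖((1 - a : ℝ) : ℂ)‖ + ‖(a : ℂ) * ((t.toCircle : ℂ) - 1)‖ := by
    refine le_trans (le_of_eq ?_) (norm_sub_le _ _)
    congr 1
    push_cast
    ring
  rw [norm_mul, Complex.norm_real, Complex.norm_real, Real.norm_of_nonneg (by linarith),
    Real.norm_of_nonneg ha] at h3
  have := mul_le_of_le_one_left (norm_nonneg ((t.toCircle : ℂ) - 1)) ha1
  linarith

theorem one_sub_le_of_mem_dyadicRadii {k : ℕ} {x : ℝ} (hx : x ∈ dyadicRadii k) (hx0 : 0 ≤ x) :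
    1 - x ≤ (2 : ℝ)⁻¹ ^ k := by
  rcases hx.2 with h | h
  · subst h
    simpa using hx0
  · exact h.le

/-- A geometric sum over dyadic scales dominates the reciprocal of the largest of the scale
`2^{-M}` and the distance `t`. -/
theorem inv_le_sum_dyadic {D t : ℝ} (M : ℕ) (hD : (2 : ℝ)⁻¹ ^ (M + 1) ≤ D) (ht : t ≤ D)
    (ht1 : t ≤ 1) :
    D⁻¹ ≤ 2 * ∑ l ∈ Finset.range (M + 1), 2 ^ l * (if t ≤ (2 : ℝ)⁻¹ ^ l then 1 else 0) := by
  have hD0 : 0 < D := lt_of_lt_of_le (by positivity) hD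
  -- Take `l` largest with `l ≤ M` and `t ≤ 2^{-l}`: either `l = M`, or `2^{-(l+1)} < t ≤ D`.
  have hex : ∃ l ≤ M, t ≤ (2 : ℝ)⁻¹ ^ l ∧ (2 : ℝ)⁻¹ ^ (l + 1) ≤ D := by
    by_cases hM : t ≤ (2 : ℝ)⁻¹ ^ M
    · exact ⟨M, le_rfl, hM, hD⟩
    · have hex' : ∃ l, ¬ t ≤ (2 : ℝ)⁻¹ ^ l := ⟨M, hM⟩
      classical
      have hs := Nat.find_spec hex'
      have hle := Nat.find_min' hex' hM
      have hpos : Nat.find hex' ≠ 0 := fun h0 => by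
        rw [h0, pow_zero] at hs
        exact hs ht1
      obtain ⟨k, hk⟩ := Nat.exists_eq_succ_of_ne_zero hpos
      refine ⟨k, by omega, ?_, ?_⟩
      · exact not_not.1 (Nat.find_min hex' (m := k) (by omega))
      · rw [hk] at hs
        exact (not_le.1 hs).le.trans ht
  obtain ⟨l, hl, h1, h2⟩ := hex
  have h3 : D⁻¹ ≤ 2 * (2 ^ l * (if t ≤ (2 : ℝ)⁻¹ ^ l then 1 else 0)) := by
    rw [if_pos h1, mul_one, ← pow_succ', inv_le_comm₀ hD0 (by positivity), ← inv_pow]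
    exact h2
  refine h3.trans (mul_le_mul_of_nonneg_left ?_ zero_le_two)
  exact Finset.single_le_sum (f := fun l => 2 ^ l * (if t ≤ (2 : ℝ)⁻¹ ^ l then (1 : ℝ) else 0))
    (fun i _ => by positivity) (Finset.mem_range.2 (by omega))

theorem sqrt_one_sub_sq_le {k : ℕ} {x : ℝ} (hx : x ∈ dyadicRadii k) (hx0 : 0 ≤ x) (hx1 : x < 1) :
    √(1 - x ^ 2) ≤ √2 * √(2⁻¹) ^ k := by
  have h := one_sub_le_of_mem_dyadicRadii hx hx0
  refine Real.sqrt_le_iff.2 ⟨by positivity, ?_⟩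
  rw [mul_pow, Real.sq_sqrt zero_le_two, ← pow_mul, mul_comm k, pow_mul,
    Real.sq_sqrt (by positivity)]
  nlinarith

theorem gram_factor_le {k k' : ℕ} {x y : ℝ} (hx : x ∈ dyadicRadii k) (hx0 : 0 ≤ x) (hx1 : x < 1)
    (hy : y ∈ dyadicRadii k') (hy0 : 0 ≤ y) (hy1 : y < 1) (t : UnitAddCircle) :
    √(1 - x ^ 2) * √(1 - y ^ 2) / ‖1 - ((x * y : ℝ) : ℂ) * (t.toCircle : ℂ)‖ ≤
      ∑ l ∈ Finset.range (min k k' + 1),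
        4 * (√(2⁻¹) ^ k * √(2⁻¹) ^ k') * (2 ^ l * (if ‖t‖ ≤ (2 : ℝ)⁻¹ ^ l then 1 else 0)) := by
  have hxy : x * y ≤ min x y := le_min (by nlinarith) (by nlinarith)
  have hD1 := one_sub_le_norm_one_sub_mul_toCircle (mul_nonneg hx0 hy0) t
  have hD2 := norm_le_norm_one_sub_mul_toCircle (mul_nonneg hx0 hy0) (by nlinarith) t
  have hD : (2 : ℝ)⁻¹ ^ (min k k' + 1) ≤ ‖1 - ((x * y : ℝ) : ℂ) * (t.toCircle : ℂ)‖ := by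
    refine le_trans ?_ hD1
    rcases min_cases k k' with ⟨h, -⟩ | ⟨h, -⟩ <;> rw [h]
    · linarith [hx.1, min_le_left x y]
    · linarith [hy.1, min_le_right x y]
  have h := inv_le_sum_dyadic _ hD hD2 (by linarith [norm_unitAddCircle_le_half t])
  rw [div_eq_mul_inv, ← Finset.mul_sum]
  calc _ ≤ ((√2 * √(2⁻¹) ^ k) * (√2 * √(2⁻¹) ^ k')) *
        (2 * ∑ l ∈ Finset.range (min k k' + 1),
          2 ^ l * (if ‖t‖ ≤ (2 : ℝ)⁻¹ ^ l then 1 else 0)) := by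
        gcongr
        · exact sqrt_one_sub_sq_le hx hx0 hx1
        · exact sqrt_one_sub_sq_le hy hy0 hy1
    _ = (√2 * √2) * (√(2⁻¹) ^ k * √(2⁻¹) ^ k') *
        (2 * ∑ l ∈ Finset.range (min k k' + 1),
          2 ^ l * (if ‖t‖ ≤ (2 : ℝ)⁻¹ ^ l then 1 else 0)) := by ring
    _ = _ := by
        rw [Real.mul_self_sqrt zero_le_two]
        ring

theorem le_gram_factor {k : ℕ} {x y : ℝ} (hx : x ∈ dyadicRadii k) (hx0 : 0 ≤ x) (hx1 : x < 1)
    (hy : y ∈ dyadicRadii k) (hy0 : 0 ≤ y) (hy1 : y < 1) {t : UnitAddCircle}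
    (ht : ‖t‖ ≤ (2 : ℝ)⁻¹ ^ k) :
    18⁻¹ ≤ √(1 - x ^ 2) * √(1 - y ^ 2) / ‖1 - ((x * y : ℝ) : ℂ) * (t.toCircle : ℂ)‖ := by
  have hD := norm_one_sub_mul_toCircle_le (mul_nonneg hx0 hy0) (by nlinarith) t
  have hD1 := one_sub_le_norm_one_sub_mul_toCircle (mul_nonneg hx0 hy0) t
  have h1 := one_sub_le_of_mem_dyadicRadii hx hx0
  have h2 := one_sub_le_of_mem_dyadicRadii hy hy0
  have h3 : (2 : ℝ)⁻¹ ^ (k + 1) ≤ √(1 - x ^ 2) * √(1 - y ^ 2) := by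
    rw [← Real.sqrt_mul (by nlinarith)]
    refine Real.le_sqrt_of_sq_le ?_
    rw [sq]
    exact mul_le_mul (by nlinarith [hx.1]) (by nlinarith [hy.1]) (by positivity) (by nlinarith)
  rw [pow_succ] at h3
  rw [le_div_iff₀ (by nlinarith)]
  nlinarith

variable {d : ℕ}

theorem normalizedGram_polarPoint (r ρ : Fin d → Set.Ico (0 : ℝ) 1) (θ φ : Fin d → UnitAddCircle) :
    normalizedGram (HardySpace d) (polarPoint r θ) (polarPoint ρ φ) =
      ∏ i, √(1 - (r i : ℝ) ^ 2) * √(1 - (ρ i : ℝ) ^ 2) /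
        ‖1 - (((r i : ℝ) * (ρ i : ℝ) : ℝ) : ℂ) * ((θ i - φ i).toCircle : ℂ)‖ := by
  have hn : ∀ (r : Fin d → Set.Ico (0 : ℝ) 1) (θ : Fin d → UnitAddCircle) i,
      ‖(polarPoint r θ).1 i‖ = r i := fun r θ i => by
    simp only [polarPoint]
    rw [norm_mul, Circle.norm_coe, mul_one, Complex.norm_real, Real.norm_of_nonneg (r i).2.1]
  rw [normalizedGram_eq]
  refine Finset.prod_congr rfl fun i _ => ?_
  rw [hn, hn]
  congr 3
  simp only [polarPoint, map_mul, Complex.conj_ofReal, sub_eq_add_neg, AddCircle.toCircle_add,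
    AddCircle.toCircle_neg, Circle.coe_mul, Circle.coe_inv_eq_conj]
  push_cast
  ring

/-- Off-diagonal decay of the normalized Gram matrix, as a sum over dyadic boxes `l` containing
both angles, none of them finer than either of the two regions. -/
theorem normalizedGram_polarPoint_le {m m' : Fin d → ℕ} {r ρ : Fin d → Set.Ico (0 : ℝ) 1}
    (hr : ∀ i, (r i : ℝ) ∈ dyadicRadii (m i)) (hρ : ∀ i, (ρ i : ℝ) ∈ dyadicRadii (m' i))
    (θ φ : Fin d → UnitAddCircle) :
    normalizedGram (HardySpace d) (polarPoint r θ) (polarPoint ρ φ) ≤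
      ∑ l ∈ Fintype.piFinset fun i => Finset.range (min (m i) (m' i) + 1),
        (∏ i, 4 * (√(2⁻¹) ^ m i * √(2⁻¹) ^ m' i) * 2 ^ l i) *
          (if ∀ i, ‖θ i - φ i‖ ≤ (2 : ℝ)⁻¹ ^ l i then 1 else 0) := by
  rw [normalizedGram_polarPoint]
  refine (Finset.prod_le_prod (fun i _ => by positivity) fun i _ => gram_factor_le (hr i)
    (r i).2.1 (r i).2.2 (hρ i) (ρ i).2.1 (ρ i).2.2 (θ i - φ i)).trans (le_of_eq ?_)
  rw [Finset.prod_univ_sum]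
  refine Finset.sum_congr rfl fun l _ => ?_
  simp only [← mul_assoc]
  rw [Finset.prod_mul_distrib]
  congr 1
  by_cases h : ∀ i, ‖θ i - φ i‖ ≤ (2 : ℝ)⁻¹ ^ l i
  · simp only [h, implies_true, if_true, Finset.prod_const_one]
  · rw [if_neg h]
    push Not at h
    obtain ⟨i, hi⟩ := h
    exact Finset.prod_eq_zero (Finset.mem_univ i) (if_neg hi.not_ge)

/-- The normalized kernel functions at two points of a region with nearby angles are far from
orthogonal. -/
theorem le_normalizedGram_polarPoint {m : Fin d → ℕ} {r ρ : Fin d → Set.Ico (0 : ℝ) 1}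
    (hr : ∀ i, (r i : ℝ) ∈ dyadicRadii (m i)) (hρ : ∀ i, (ρ i : ℝ) ∈ dyadicRadii (m i))
    {θ φ : Fin d → UnitAddCircle} (h : ∀ i, ‖θ i - φ i‖ ≤ (2 : ℝ)⁻¹ ^ m i) :
    18⁻¹ ^ d ≤ normalizedGram (HardySpace d) (polarPoint r θ) (polarPoint ρ φ) := by
  rw [normalizedGram_polarPoint]
  refine le_trans (le_of_eq (by simp)) (Finset.prod_le_prod (s := Finset.univ)
    (f := fun _ : Fin d => (18⁻¹ : ℝ)) (fun i _ => by positivity) fun i _ =>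
    le_gram_factor (hr i) (r i).2.1 (r i).2.2 (hρ i) (ρ i).2.1 (ρ i).2.2 (h i))

end Geometry

/-! ### From box counts to the Carleson property -/

section BoxCounts

theorem sum_pow_le_of_injOn {q : ℝ} (hq0 : 0 ≤ q) (hq1 : q < 1) (s : Finset ℕ) (e : ℕ → ℕ)
    (he : Set.InjOn e s) : ∑ k ∈ s, q ^ e k ≤ (1 - q)⁻¹ := by
  rw [← tsum_geometric_of_lt_one hq0 hq1, ← Finset.sum_image (f := fun k => q ^ k) he]
  exact (summable_geometric_of_lt_one hq0 hq1).sum_le_tsum _ fun _ _ => by positivity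

theorem sum_pow_dist_le {q : ℝ} (hq0 : 0 ≤ q) (hq1 : q < 1) (a : ℕ) (s : Finset ℕ) :
    ∑ k ∈ s, q ^ ((a - k) + (k - a)) ≤ 2 * (1 - q)⁻¹ := by
  rw [← Finset.sum_filter_add_sum_filter_not s (fun k => k ≤ a), two_mul]
  refine add_le_add (sum_pow_le_of_injOn hq0 hq1 _ _ ?_) (sum_pow_le_of_injOn hq0 hq1 _ _ ?_)
  · intro x hx y hy hxy
    simp only [Finset.coe_filter, Set.mem_ofPred_eq] at hx hy hxy
    omega
  · intro x hx y hy hxy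
    simp only [Finset.coe_filter, Set.mem_ofPred_eq] at hx hy hxy
    omega

theorem sum_prod_le {d : ℕ} (I : Finset (Fin d → ℕ)) (f : Fin d → ℕ → ℝ)
    (hf : ∀ i k, 0 ≤ f i k) {B : ℝ} (hB : ∀ i (s : Finset ℕ), ∑ k ∈ s, f i k ≤ B) :
    ∑ m ∈ I, ∏ i, f i (m i) ≤ B ^ d := by
  classical
  calc ∑ m ∈ I, ∏ i, f i (m i)
      ≤ ∑ m ∈ Fintype.piFinset fun i => I.image fun m => m i, ∏ i, f i (m i) := by
        refine Finset.sum_le_sum_of_subset_of_nonneg (fun m hm => ?_) fun m _ _ =>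
          Finset.prod_nonneg fun i _ => hf i _
        exact Fintype.mem_piFinset.2 fun i => Finset.mem_image_of_mem _ hm
    _ = ∏ i, ∑ k ∈ I.image fun m => m i, f i k := (Finset.prod_univ_sum _ _).symm
    _ ≤ ∏ _i : Fin d, B := Finset.prod_le_prod
        (fun i _ => Finset.sum_nonneg fun k _ => hf i k) fun i _ => hB i _
    _ = B ^ d := by simp

theorem sum_two_pow_range_le (n : ℕ) : ∑ l ∈ Finset.range (n + 1), (2 : ℝ) ^ l ≤ 2 * 2 ^ n := by
  rw [geom_sum_eq (by norm_num)]
  norm_num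
  rw [pow_succ]
  linarith

theorem sqrt_half_pow_mul_pow (k : ℕ) : √(2⁻¹ : ℝ) ^ k * √(2⁻¹) ^ k * 2 ^ k = 1 := by
  rw [← mul_pow, ← mul_pow, Real.mul_self_sqrt (by norm_num)]
  norm_num

/-- With the weights `(√2⁻¹ / q)^k`, the part of the row sums that comes from the finest boxes
decays geometrically in the distance of the scales. -/
theorem weighted_fine_factor_le {q : ℝ} (hq : √2⁻¹ ≤ q) (k k' : ℕ) :
    (∑ l ∈ Finset.range (min k k' + 1), 4 * (√2⁻¹ ^ k * √2⁻¹ ^ k') * 2 ^ l) *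
        (√2⁻¹ / q) ^ k' ≤
      8 * q ^ ((k - k') + (k' - k)) * (√2⁻¹ / q) ^ k := by
  have hs0 : 0 < √(2⁻¹ : ℝ) := by positivity
  have hq0 : 0 < q := hs0.trans_le hq
  have h1 : √(2⁻¹ : ℝ) ^ k * √2⁻¹ ^ k' * 2 ^ min k k' * (√2⁻¹ / q) ^ k' ≤
      q ^ ((k - k') + (k' - k)) * (√2⁻¹ / q) ^ k := by
    rcases le_total k k' with h | h
    · obtain ⟨j, rfl⟩ := Nat.exists_eq_add_of_le h
      have e := sqrt_half_pow_mul_pow k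
      have h2 : √(2⁻¹ : ℝ) ^ j * (√2⁻¹ / q) ^ j ≤ q ^ j := by
        rw [← mul_pow]
        refine pow_le_pow_left₀ (by positivity) ?_ _
        rw [← mul_div_assoc, div_le_iff₀ hq0]
        exact mul_le_mul hq hq hs0.le hq0.le
      rw [min_eq_left h, Nat.sub_eq_zero_of_le h, zero_add, Nat.add_sub_cancel_left, pow_add,
        pow_add]
      calc _ = (√2⁻¹ ^ k * √2⁻¹ ^ k * 2 ^ k) * (√2⁻¹ ^ j * (√2⁻¹ / q) ^ j) *
            (√2⁻¹ / q) ^ k := by ring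
        _ ≤ 1 * q ^ j * (√2⁻¹ / q) ^ k := by rw [e]; gcongr
        _ = _ := by ring
    · obtain ⟨j, rfl⟩ := Nat.exists_eq_add_of_le h
      have e := sqrt_half_pow_mul_pow k'
      rw [min_eq_right h, Nat.sub_eq_zero_of_le h, add_zero, Nat.add_sub_cancel_left, pow_add,
        pow_add]
      have h2 : q ^ j * (√2⁻¹ / q) ^ j = √(2⁻¹ : ℝ) ^ j := by
        rw [← mul_pow, mul_div_cancel₀ _ hq0.ne']
      refine le_of_eq ?_
      calc _ = (√2⁻¹ ^ k' * √2⁻¹ ^ k' * 2 ^ k') * √2⁻¹ ^ j * (√2⁻¹ / q) ^ k' := by ring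
        _ = 1 * (q ^ j * (√2⁻¹ / q) ^ j) * (√2⁻¹ / q) ^ k' := by rw [e, h2]
        _ = _ := by ring
  rw [← Finset.mul_sum]
  calc _ ≤ (4 * (√2⁻¹ ^ k * √2⁻¹ ^ k') * (2 * 2 ^ min k k')) * (√2⁻¹ / q) ^ k' := by
        gcongr
        exact sum_two_pow_range_le _
    _ = 8 * (√2⁻¹ ^ k * √2⁻¹ ^ k' * 2 ^ min k k' * (√2⁻¹ / q) ^ k') := by ring
    _ ≤ _ := by
        rw [mul_assoc 8]
        exact mul_le_mul_of_nonneg_left h1 (by norm_num)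

/-- With the weights `(√2⁻¹ / q)^k`, the part of the row sums that comes from the expected box
counts is summable in the scale `k'`. -/
theorem weighted_mean_factor_le {q : ℝ} (hq : √2⁻¹ ≤ q) (hq1 : q ≤ 1) (k k' : ℕ) :
    (∑ l ∈ Finset.range (min k k' + 1),
        4 * (√2⁻¹ ^ k * √2⁻¹ ^ k') * 2 ^ l * ((2 * q ^ 2) ^ k' / 2 ^ l)) * (√2⁻¹ / q) ^ k' ≤
      4 * ((k' : ℝ) + 1) * q ^ k' * (√2⁻¹ / q) ^ k := by
  have hs0 : 0 < √(2⁻¹ : ℝ) := by positivity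
  have hq0 : 0 < q := hs0.trans_le hq
  have h1 : ∀ l ∈ Finset.range (min k k' + 1),
      4 * (√2⁻¹ ^ k * √2⁻¹ ^ k') * 2 ^ l * ((2 * q ^ 2) ^ k' / 2 ^ l) =
        4 * (√2⁻¹ ^ k * √(2⁻¹ : ℝ) ^ k') * (2 * q ^ 2) ^ k' := fun l _ => by
    field_simp
  rw [Finset.sum_congr rfl h1, Finset.sum_const, Finset.card_range, nsmul_eq_mul]
  have h2 : √2⁻¹ ^ k' * (2 * q ^ 2) ^ k' * (√(2⁻¹ : ℝ) / q) ^ k' = q ^ k' := by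
    rw [← mul_pow, ← mul_pow]
    congr 1
    calc _ = (√(2⁻¹ : ℝ) * √2⁻¹) * 2 * (q ^ 2 / q) := by ring
      _ = q := by
        rw [Real.mul_self_sqrt (by norm_num), sq, mul_div_cancel_right₀ _ hq0.ne']
        ring
  have h3 : √(2⁻¹ : ℝ) ^ k ≤ (√2⁻¹ / q) ^ k := by
    refine pow_le_pow_left₀ hs0.le ?_ _
    rw [le_div_iff₀ hq0]
    exact mul_le_of_le_one_right hs0.le hq1
  have h4 : ((min k k' + 1 : ℕ) : ℝ) ≤ (k' : ℝ) + 1 := by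
    exact_mod_cast Nat.succ_le_succ (min_le_right k k')
  calc _ = ((min k k' + 1 : ℕ) : ℝ) * (4 * √2⁻¹ ^ k *
        (√2⁻¹ ^ k' * (2 * q ^ 2) ^ k' * (√2⁻¹ / q) ^ k')) := by ring
    _ ≤ ((k' : ℝ) + 1) * (4 * (√2⁻¹ / q) ^ k * q ^ k') := by
        rw [h2]
        gcongr
    _ = _ := by ring

variable {d : ℕ}

/-- The contribution of one region to a weighted row sum of the Gram matrix. -/
theorem sum_region_normalizedGram_le {q K : ℝ} (hq : √2⁻¹ ≤ q) (hq1 : q ≤ 1) (hK : 0 ≤ K)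
    {r : ℕ → Fin d → Set.Ico (0 : ℝ) 1} {θ : ℕ → Fin d → UnitAddCircle} {m m' : Fin d → ℕ}
    {n : ℕ} {J : Finset ℕ} (hn : ∀ i, (r n i : ℝ) ∈ dyadicRadii (m i))
    (hJ : ∀ j ∈ J, ∀ i, (r j i : ℝ) ∈ dyadicRadii (m' i))
    (hcount : ∀ l : Fin d → ℕ, (∀ i, l i ≤ m' i) →
      ((J.filter fun j => ∀ i, ‖θ n i - θ j i‖ ≤ (2 : ℝ)⁻¹ ^ l i).card : ℝ) ≤
        K * (1 + ∏ i, (2 * q ^ 2) ^ m' i / 2 ^ l i)) :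
    ∑ j ∈ J, normalizedGram (HardySpace d) (polarPoint (r n) (θ n)) (polarPoint (r j) (θ j)) *
        ∏ i, (√2⁻¹ / q) ^ m' i ≤
      K * (∏ i, 8 * q ^ ((m i - m' i) + (m' i - m i)) +
        ∏ i, 4 * ((m' i : ℝ) + 1) * q ^ m' i) * ∏ i, (√2⁻¹ / q) ^ m i := by
  have hs0 : 0 < √(2⁻¹ : ℝ) := by positivity
  have hq0 : 0 < q := hs0.trans_le hq
  set S := Fintype.piFinset fun i => Finset.range (min (m i) (m' i) + 1) with hS
  set c : (Fin d → ℕ) → ℝ := fun l => ∏ i, 4 * (√2⁻¹ ^ m i * √2⁻¹ ^ m' i) * 2 ^ l i with hc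
  have hc0 : ∀ l, 0 ≤ c l := fun l => Finset.prod_nonneg fun i _ => by positivity
  have h1 : ∑ j ∈ J, normalizedGram (HardySpace d) (polarPoint (r n) (θ n))
      (polarPoint (r j) (θ j)) ≤
        ∑ l ∈ S, c l * (K * (1 + ∏ i, (2 * q ^ 2) ^ m' i / 2 ^ l i)) := by
    calc _ ≤ ∑ j ∈ J, ∑ l ∈ S, c l *
          (if ∀ i, ‖θ n i - θ j i‖ ≤ (2 : ℝ)⁻¹ ^ l i then 1 else 0) :=
          Finset.sum_le_sum fun j hj => normalizedGram_polarPoint_le hn (hJ j hj) _ _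
      _ = ∑ l ∈ S, c l *
          ((J.filter fun j => ∀ i, ‖θ n i - θ j i‖ ≤ (2 : ℝ)⁻¹ ^ l i).card : ℝ) := by
          rw [Finset.sum_comm]
          refine Finset.sum_congr rfl fun l _ => ?_
          rw [← Finset.mul_sum, Finset.sum_boole]
      _ ≤ _ := by
          refine Finset.sum_le_sum fun l hl => mul_le_mul_of_nonneg_left (hcount l fun i => ?_)
            (hc0 l)
          have := Finset.mem_range.1 (Fintype.mem_piFinset.1 hl i)
          have := min_le_right (m i) (m' i)
          omega
  have h2 : ∑ l ∈ S, c l * (K * (1 + ∏ i, (2 * q ^ 2) ^ m' i / 2 ^ l i)) =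
      K * (∏ i, ∑ l ∈ Finset.range (min (m i) (m' i) + 1),
          4 * (√2⁻¹ ^ m i * √2⁻¹ ^ m' i) * 2 ^ l +
        ∏ i, ∑ l ∈ Finset.range (min (m i) (m' i) + 1),
          4 * (√2⁻¹ ^ m i * √2⁻¹ ^ m' i) * 2 ^ l * ((2 * q ^ 2) ^ m' i / 2 ^ l)) := by
    rw [Finset.prod_univ_sum, Finset.prod_univ_sum, ← hS, ← Finset.sum_add_distrib,
      Finset.mul_sum]
    refine Finset.sum_congr rfl fun l _ => ?_
    have e : ∏ i, 4 * (√2⁻¹ ^ m i * √2⁻¹ ^ m' i) * 2 ^ l i * ((2 * q ^ 2) ^ m' i / 2 ^ l i) =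
        c l * ∏ i, (2 * q ^ 2) ^ m' i / 2 ^ l i := Finset.prod_mul_distrib
    rw [e, mul_left_comm, mul_add, mul_one]
  rw [← Finset.sum_mul]
  calc _ ≤ K * (∏ i, ∑ l ∈ Finset.range (min (m i) (m' i) + 1),
          4 * (√2⁻¹ ^ m i * √2⁻¹ ^ m' i) * 2 ^ l +
        ∏ i, ∑ l ∈ Finset.range (min (m i) (m' i) + 1),
          4 * (√2⁻¹ ^ m i * √2⁻¹ ^ m' i) * 2 ^ l * ((2 * q ^ 2) ^ m' i / 2 ^ l)) *
        ∏ i, (√2⁻¹ / q) ^ m' i := by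
        rw [← h2]
        exact mul_le_mul_of_nonneg_right h1 (Finset.prod_nonneg fun i _ => by positivity)
    _ = K * (∏ i, (∑ l ∈ Finset.range (min (m i) (m' i) + 1),
          4 * (√2⁻¹ ^ m i * √2⁻¹ ^ m' i) * 2 ^ l) * (√2⁻¹ / q) ^ m' i +
        ∏ i, (∑ l ∈ Finset.range (min (m i) (m' i) + 1),
          4 * (√2⁻¹ ^ m i * √2⁻¹ ^ m' i) * 2 ^ l * ((2 * q ^ 2) ^ m' i / 2 ^ l)) *
        (√2⁻¹ / q) ^ m' i) := by
        rw [Finset.prod_mul_distrib, Finset.prod_mul_distrib]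
        ring
    _ ≤ K * (∏ i, 8 * q ^ ((m i - m' i) + (m' i - m i)) * (√2⁻¹ / q) ^ m i +
        ∏ i, 4 * ((m' i : ℝ) + 1) * q ^ m' i * (√2⁻¹ / q) ^ m i) := by
        refine mul_le_mul_of_nonneg_left (add_le_add ?_ ?_) hK
        · exact Finset.prod_le_prod (fun i _ => by positivity)
            fun i _ => weighted_fine_factor_le hq _ _
        · exact Finset.prod_le_prod (fun i _ => by positivity)
            fun i _ => weighted_mean_factor_le hq hq1 _ _
    _ = _ := by
        rw [Finset.prod_mul_distrib (g := fun i => (√2⁻¹ / q) ^ m i),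
          Finset.prod_mul_distrib (g := fun i => (√2⁻¹ / q) ^ m i), ← add_mul, mul_assoc]

/-- A sequence is Carleson as soon as, in every region `A_{m'}`, the number of points whose angles
lie in a box of side lengths `2^{-l i}`, `l ≤ m'`, is at most `K (1 + ∏ (2 q²)^{m' i} 2^{-l i})`
with `q < 1`. Schur's test is applied with the weights `∏ (√2⁻¹ / q)^{m i}`. -/
theorem isCarlesonSequence_of_box_counts {q K : ℝ} (hq : √2⁻¹ ≤ q) (hq1 : q < 1) (hK : 0 ≤ K)
    {r : ℕ → Fin d → Set.Ico (0 : ℝ) 1} {θ : ℕ → Fin d → UnitAddCircle} {m : ℕ → Fin d → ℕ}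
    (hm : ∀ n i, (r n i : ℝ) ∈ dyadicRadii (m n i))
    (hcount : ∀ m' l : Fin d → ℕ, (∀ i, l i ≤ m' i) → ∀ (c : Fin d → UnitAddCircle)
      (J : Finset ℕ), (∀ j ∈ J, m j = m' ∧ ∀ i, ‖c i - θ j i‖ ≤ (2 : ℝ)⁻¹ ^ l i) →
      (J.card : ℝ) ≤ K * (1 + ∏ i, (2 * q ^ 2) ^ m' i / 2 ^ l i)) :
    IsCarlesonSequence (HardySpace d) fun n => polarPoint (r n) (θ n) := by
  classical
  have hs0 : 0 < √(2⁻¹ : ℝ) := by positivity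
  have hq0 : 0 < q := hs0.trans_le hq
  have hsum : Summable fun k : ℕ => ((k : ℝ) + 1) * q ^ k := by
    have h1 := summable_pow_mul_geometric_of_norm_lt_one 1
      (show ‖q‖ < 1 by rwa [Real.norm_of_nonneg hq0.le])
    have h2 := summable_geometric_of_lt_one hq0.le hq1
    refine (h1.add h2).congr fun k => ?_
    ring
  set B₁ : ℝ := 8 * (2 * (1 - q)⁻¹)
  set B₂ : ℝ := 4 * ∑' k : ℕ, ((k : ℝ) + 1) * q ^ k
  refine isCarlesonSequence_of_schur (fun n => kernelAt_ne_zero _)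
    (fun n => ∏ i, (√2⁻¹ / q) ^ m n i) (fun n => Finset.prod_pos fun i _ => by positivity)
    (K * (B₁ ^ d + B₂ ^ d)) fun n J => ?_
  rw [← Finset.sum_fiberwise_of_maps_to (t := J.image m)
    (fun j hj => Finset.mem_image_of_mem m hj)]
  have h1 : ∀ m' ∈ J.image m, ∑ j ∈ J.filter (fun j => m j = m'),
      normalizedGram (HardySpace d) (polarPoint (r n) (θ n)) (polarPoint (r j) (θ j)) *
        ∏ i, (√2⁻¹ / q) ^ m j i ≤
      K * (∏ i, 8 * q ^ ((m n i - m' i) + (m' i - m n i)) +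
        ∏ i, 4 * ((m' i : ℝ) + 1) * q ^ m' i) * ∏ i, (√2⁻¹ / q) ^ m n i := by
    intro m' _
    rw [Finset.sum_congr rfl (g := fun j => normalizedGram (HardySpace d)
      (polarPoint (r n) (θ n)) (polarPoint (r j) (θ j)) * ∏ i, (√2⁻¹ / q) ^ m' i)
      fun j hj => by rw [(Finset.mem_filter.1 hj).2]]
    refine sum_region_normalizedGram_le hq hq1.le hK (hm n) (fun j hj => ?_) fun l hl => ?_
    · rw [← (Finset.mem_filter.1 hj).2]
      exact hm j
    · refine hcount m' l hl (θ n) _ fun j hj => ?_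
      simp only [Finset.mem_filter] at hj
      exact ⟨hj.1.2, hj.2⟩
  refine (Finset.sum_le_sum h1).trans ?_
  rw [← Finset.sum_mul, ← Finset.mul_sum, Finset.sum_add_distrib]
  refine mul_le_mul_of_nonneg_right (mul_le_mul_of_nonneg_left (add_le_add ?_ ?_) hK)
    (Finset.prod_nonneg fun i _ => by positivity)
  · refine sum_prod_le _ (fun i k => 8 * q ^ ((m n i - k) + (k - m n i)))
      (fun i k => by positivity) fun i s => ?_
    rw [← Finset.mul_sum]
    exact mul_le_mul_of_nonneg_left (sum_pow_dist_le hq0.le hq1 _ _) (by norm_num)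
  · refine sum_prod_le _ (fun _ k => 4 * ((k : ℝ) + 1) * q ^ k)
      (fun i k => by positivity) fun i s => ?_
    simp only [mul_assoc]
    rw [← Finset.mul_sum]
    exact mul_le_mul_of_nonneg_left (hsum.sum_le_tsum _ fun _ _ => by positivity) (by norm_num)

end BoxCounts

/-! ### Random points in boxes of the torus -/

section Torus

variable {d : ℕ}

/-- The closed box in the torus with centre `c` and half side lengths `ρ i`. -/
def torusBox (c : Fin d → UnitAddCircle) (ρ : Fin d → ℝ) : Set (Fin d → UnitAddCircle) :=
  {x | ∀ i, ‖c i - x i‖ ≤ ρ i}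

theorem torusBox_eq_pi (c : Fin d → UnitAddCircle) (ρ : Fin d → ℝ) :
    torusBox c ρ = Set.pi Set.univ fun i => Metric.closedBall (c i) (ρ i) := by
  ext x
  simp only [torusBox, Set.mem_pi, Metric.mem_closedBall', dist_eq_norm, Set.mem_ofPred_eq,
    Set.mem_univ, true_imp_iff]

theorem measurableSet_torusBox (c : Fin d → UnitAddCircle) (ρ : Fin d → ℝ) :
    MeasurableSet (torusBox c ρ) := by
  rw [torusBox_eq_pi]
  exact MeasurableSet.univ_pi fun i => Metric.isClosed_closedBall.measurableSet

theorem torusMeasure_torusBox_le (c : Fin d → UnitAddCircle) (ρ : Fin d → ℝ)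
    (hρ : ∀ i, 0 ≤ ρ i) : torusMeasure d (torusBox c ρ) ≤ ENNReal.ofReal (∏ i, 2 * ρ i) := by
  rw [torusBox_eq_pi, torusMeasure, Measure.pi_pi,
    ENNReal.ofReal_prod_of_nonneg fun i _ => by have := hρ i; positivity]
  refine Finset.prod_le_prod' fun i _ => ?_
  have h : (volume : Measure UnitAddCircle) = AddCircle.haarAddCircle := by
    rw [AddCircle.volume_eq_smul_haarAddCircle]
    simp
  rw [← h, AddCircle.volume_closedBall]
  exact ENNReal.ofReal_le_ofReal (min_le_right _ _)

/-- The midpoint of the cell `g` of the dyadic grid with side lengths `2^{-l i}`. -/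
noncomputable def gridPoint (l : Fin d → ℕ) (g : ∀ i, Fin (2 ^ l i)) : Fin d → UnitAddCircle :=
  fun i => ((((g i : ℕ) + 2⁻¹ : ℝ) * 2⁻¹ ^ l i : ℝ) : UnitAddCircle)

theorem exists_mem_torusBox_gridPoint (l : Fin d → ℕ) (x : Fin d → UnitAddCircle) :
    ∃ g : ∀ i, Fin (2 ^ l i), x ∈ torusBox (gridPoint l g) fun i => 2⁻¹ ^ (l i + 1) := by
  have h : ∀ i, ∃ g : Fin (2 ^ l i),
      ‖((((g : ℕ) + 2⁻¹ : ℝ) * 2⁻¹ ^ l i : ℝ) : UnitAddCircle) - x i‖ ≤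
        (2 : ℝ)⁻¹ ^ (l i + 1) := by
    intro i
    obtain ⟨y, hy, hyx⟩ : ∃ y ∈ Set.Ico (0 : ℝ) (0 + 1), (y : UnitAddCircle) = x i := by
      have := AddCircle.coe_image_Ico_eq (1 : ℝ) 0
      have hx : x i ∈ (Set.univ : Set (AddCircle (1 : ℝ))) := Set.mem_univ _
      rw [← this] at hx
      exact hx
    rw [zero_add] at hy
    have hpos : (0 : ℝ) < 2 ^ l i := by positivity
    have hy0 : 0 ≤ y * 2 ^ l i := mul_nonneg hy.1 hpos.le
    have h1 := Nat.floor_le hy0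
    have h2 := Nat.lt_floor_add_one (y * 2 ^ l i)
    have hlt : ⌊y * 2 ^ l i⌋₊ < 2 ^ l i := by
      rw [Nat.floor_lt hy0]
      push_cast
      nlinarith [hy.2]
    refine ⟨⟨_, hlt⟩, ?_⟩
    rw [← hyx, ← AddCircle.coe_sub]
    refine (UnitAddCircle.norm_eq.trans_le (round_le _ 0)).trans ?_
    have hpow : (2 : ℝ) ^ l i * 2⁻¹ ^ l i = 1 := by
      rw [← mul_pow]
      norm_num
    have e : ((⌊y * 2 ^ l i⌋₊ : ℝ) + 2⁻¹) * 2⁻¹ ^ l i - y =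
        ((⌊y * 2 ^ l i⌋₊ : ℝ) + 2⁻¹ - y * 2 ^ l i) * 2⁻¹ ^ l i := by
      rw [sub_mul, mul_assoc y, hpow, mul_one]
    simp only [Int.cast_zero, sub_zero]
    rw [e, abs_mul, abs_of_nonneg (show (0 : ℝ) ≤ 2⁻¹ ^ l i by positivity), pow_succ,
      mul_comm _ (2⁻¹ : ℝ)]
    refine mul_le_mul_of_nonneg_right ?_ (by positivity)
    rw [abs_le]
    constructor <;> linarith
  choose g hg using h
  exact ⟨g, hg⟩

variable {Ω : Type*} [MeasurableSpace Ω] {P : Measure Ω}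
  {θ : ℕ → Ω → Fin d → UnitAddCircle}

theorem measure_forall_mem_le (hlaw : ∀ n, HasLaw (θ n) (torusMeasure d) P)
    (hindep : iIndepFun θ P) (J : Finset ℕ) (U : ℕ → Set (Fin d → UnitAddCircle))
    (hU : ∀ n ∈ J, MeasurableSet (U n)) {p : ℝ≥0∞} (hp : ∀ n ∈ J, torusMeasure d (U n) ≤ p) :
    P {ω | ∀ n ∈ J, θ n ω ∈ U n} ≤ p ^ J.card := by
  have h := hindep.measure_inter_preimage_eq_mul J hU
  have e : {ω | ∀ n ∈ J, θ n ω ∈ U n} = ⋂ n ∈ J, θ n ⁻¹' U n := by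
    ext ω
    simp
  rw [e, h]
  refine Finset.prod_le_pow_card _ _ _ fun n hn => ?_
  rw [← Measure.map_apply_of_aemeasurable (hlaw n).aemeasurable (hU n hn), (hlaw n).map_eq]
  exact hp n hn

/-- The union bound for the number of random points in a set. -/
theorem measure_exists_powersetCard_le (hlaw : ∀ n, HasLaw (θ n) (torusMeasure d) P)
    (hindep : iIndepFun θ P) (S : Finset ℕ) (T : ℕ) {U : Set (Fin d → UnitAddCircle)}
    (hU : MeasurableSet U) {p : ℝ} (hp0 : 0 ≤ p) (hp : torusMeasure d U ≤ ENNReal.ofReal p) :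
    P {ω | ∃ J ∈ S.powersetCard T, ∀ n ∈ J, θ n ω ∈ U} ≤
      ENNReal.ofReal ((S.card * p) ^ T / T.factorial) := by
  have e : {ω | ∃ J ∈ S.powersetCard T, ∀ n ∈ J, θ n ω ∈ U} =
      ⋃ J ∈ S.powersetCard T, {ω | ∀ n ∈ J, θ n ω ∈ U} := by
    ext ω
    simp
  rw [e]
  calc _ ≤ ∑ J ∈ S.powersetCard T, P {ω | ∀ n ∈ J, θ n ω ∈ U} := measure_biUnion_finset_le _ _
    _ ≤ ∑ J ∈ S.powersetCard T, ENNReal.ofReal (p ^ T) := by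
        refine Finset.sum_le_sum fun J hJ => ?_
        rw [ENNReal.ofReal_pow hp0, ← (Finset.mem_powersetCard.1 hJ).2]
        exact measure_forall_mem_le hlaw hindep J (fun _ => U) (fun _ _ => hU) fun _ _ => hp
    _ = ENNReal.ofReal (S.card.choose T * p ^ T) := by
        rw [Finset.sum_const, Finset.card_powersetCard, nsmul_eq_mul,
          ENNReal.ofReal_mul (by positivity), ENNReal.ofReal_natCast]
    _ ≤ _ := by
        refine ENNReal.ofReal_le_ofReal ?_
        rw [mul_pow, mul_div_right_comm]
        gcongr
        exact Nat.choose_le_pow_div T S.card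

/-- If the mean `x` is at most `(K₀ / e) Q y`, then the Poisson tail at `T ≥ K₀ Q` is at most
`y ^ T`. -/
theorem pow_div_factorial_le {x y K₀ Q : ℝ} {T : ℕ} (hx : 0 ≤ x) (hy : 0 ≤ y)
    (hT : K₀ * Q ≤ T) (hxy : Real.exp 1 * x ≤ K₀ * Q * y) : x ^ T / T.factorial ≤ y ^ T := by
  have h1 : (T : ℝ) ^ T / T.factorial ≤ Real.exp T :=
    Real.pow_div_factorial_le_exp _ (by positivity) T
  have h2 : Real.exp (T : ℝ) = Real.exp 1 ^ T := by rw [← Real.exp_nat_mul, mul_one]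
  rw [h2] at h1
  have h3 : (Real.exp 1 * x) ^ T ≤ (T * y) ^ T :=
    pow_le_pow_left₀ (by positivity) (hxy.trans (by gcongr)) T
  have h4 : Real.exp 1 ^ T * (x ^ T / T.factorial) ≤ Real.exp 1 ^ T * y ^ T := by
    calc Real.exp 1 ^ T * (x ^ T / T.factorial) = (Real.exp 1 * x) ^ T / T.factorial := by ring
      _ ≤ (T * y) ^ T / T.factorial := by gcongr
      _ = (T : ℝ) ^ T / T.factorial * y ^ T := by ring
      _ ≤ _ := by gcongr
  exact le_of_mul_le_mul_left h4 (by positivity)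

/-- The probability that a fixed box of side lengths about `2^{-l i}` contains many more angles of
the region `A_m` than the slightly enlarged mean `∏ (2 q²)^{m i} 2^{-l i}`. -/
theorem measure_crowded_box_le (hlaw : ∀ n, HasLaw (θ n) (torusMeasure d) P)
    (hindep : iIndepFun θ P) {q C K₀ : ℝ} (hq0 : 0 < q) (hq1 : q < 1) {T₀ T : ℕ}
    (hT₀ : (q ^ 2) ^ T₀ ≤ 4⁻¹) (hK₀ : Real.exp 1 * (4 ^ d * C) ≤ K₀) (hK₀T : (T₀ : ℝ) ≤ K₀)
    (m l : Fin d → ℕ) (S : Finset ℕ) (hS : (S.card : ℝ) ≤ C * ∏ i, (2 * q ^ 4) ^ m i)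
    (hT : K₀ * (1 + ∏ i, (2 * q ^ 2) ^ m i / 2 ^ l i) ≤ T) (c : Fin d → UnitAddCircle) :
    P {ω | ∃ J ∈ S.powersetCard T, ∀ n ∈ J, θ n ω ∈ torusBox c fun i => 2 * 2⁻¹ ^ l i} ≤
      ENNReal.ofReal (∏ i, 4⁻¹ ^ m i) := by
  set Q : ℝ := ∏ i, (2 * q ^ 2) ^ m i / 2 ^ l i with hQ
  have hQ0 : 0 ≤ Q := Finset.prod_nonneg fun i _ => by positivity
  have hK₀0 : 0 ≤ K₀ := (Nat.cast_nonneg T₀).trans hK₀T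
  have hKQ := mul_nonneg hK₀0 hQ0
  rw [mul_add, mul_one] at hT
  have hp : torusMeasure d (torusBox c fun i => 2 * 2⁻¹ ^ l i) ≤
      ENNReal.ofReal (∏ i : Fin d, 4 * 2⁻¹ ^ l i) := by
    refine (torusMeasure_torusBox_le _ _ fun i => by positivity).trans (le_of_eq ?_)
    congr 1
    exact Finset.prod_congr rfl fun i _ => by ring
  refine (measure_exists_powersetCard_le hlaw hindep S T (measurableSet_torusBox _ _)
    (Finset.prod_nonneg fun i _ => by positivity) hp).trans (ENNReal.ofReal_le_ofReal ?_)
  have hT2 : T₀ ≤ T := by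
    have h : (T₀ : ℝ) ≤ T := by linarith
    exact_mod_cast h
  set y : ℝ := ∏ i, (q ^ 2) ^ m i with hy
  have hy0 : 0 ≤ y := Finset.prod_nonneg fun i _ => by positivity
  have e1 : (∏ i, (2 * q ^ 4) ^ m i) * ∏ i : Fin d, 4 * 2⁻¹ ^ l i = 4 ^ d * (Q * y) := by
    rw [hQ, hy, ← Finset.prod_mul_distrib, ← Finset.prod_mul_distrib,
      show (4 : ℝ) ^ d = ∏ _i : Fin d, 4 by simp, ← Finset.prod_mul_distrib]
    refine Finset.prod_congr rfl fun i _ => ?_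
    rw [div_eq_mul_inv, inv_pow, show 2 * q ^ 4 = (2 * q ^ 2) * q ^ 2 by ring, mul_pow]
    ring
  have hmean : Real.exp 1 * (S.card * ∏ i : Fin d, 4 * 2⁻¹ ^ l i) ≤ K₀ * Q * y := by
    have h0 : 0 ≤ ∏ i : Fin d, 4 * (2 : ℝ)⁻¹ ^ l i := Finset.prod_nonneg fun i _ => by positivity
    calc _ ≤ Real.exp 1 * ((C * ∏ i, (2 * q ^ 4) ^ m i) * ∏ i : Fin d, 4 * 2⁻¹ ^ l i) := by
          gcongr
      _ = (Real.exp 1 * (4 ^ d * C)) * (Q * y) := by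
          rw [mul_assoc C, e1]
          ring
      _ ≤ K₀ * (Q * y) := mul_le_mul_of_nonneg_right hK₀ (mul_nonneg hQ0 hy0)
      _ = _ := by ring
  refine (pow_div_factorial_le (mul_nonneg (by positivity)
    (Finset.prod_nonneg fun i _ => by positivity)) hy0 (by linarith) hmean).trans ?_
  rw [hy, ← Finset.prod_pow]
  refine Finset.prod_le_prod (fun i _ => by positivity) fun i _ => ?_
  rw [← pow_mul, mul_comm, pow_mul]
  refine pow_le_pow_left₀ (by positivity) ?_ _
  exact (pow_le_pow_of_le_one (by positivity) (by nlinarith) hT2).trans hT₀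

/-- Almost surely, all box counts are at most a constant times the maximum of `1` and a slightly
enlarged mean. -/
theorem ae_exists_box_count_le (hlaw : ∀ n, HasLaw (θ n) (torusMeasure d) P)
    (hindep : iIndepFun θ P) {q C : ℝ} (hq0 : 0 < q) (hq1 : q < 1)
    (S : (Fin d → ℕ) → Finset ℕ) (hS : ∀ m, ((S m).card : ℝ) ≤ C * ∏ i, (2 * q ^ 4) ^ m i) :
    ∀ᵐ ω ∂P, ∃ K : ℝ, 0 ≤ K ∧ ∀ m l : Fin d → ℕ, (∀ i, l i ≤ m i) →
      ∀ (c : Fin d → UnitAddCircle) (J : Finset ℕ), J ⊆ S m →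
        (∀ j ∈ J, ∀ i, ‖c i - θ j ω i‖ ≤ (2 : ℝ)⁻¹ ^ l i) →
          (J.card : ℝ) ≤ K * (1 + ∏ i, (2 * q ^ 2) ^ m i / 2 ^ l i) := by
  classical
  obtain ⟨T₀, hT₀⟩ := exists_pow_lt_of_lt_one (show (0 : ℝ) < 4⁻¹ by norm_num)
    (show q ^ 2 < 1 by nlinarith)
  -- `K₀ ≥ e 4^d C` makes the Poisson tails small, `K₀ ≥ T₀` makes them summable over the boxes.
  set K₀ : ℝ := max (Real.exp 1 * (4 ^ d * C)) T₀ with hK₀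
  have hK₀0 : 0 ≤ K₀ := (show (0 : ℝ) ≤ T₀ by positivity).trans (le_max_right _ _)
  let Q : (Fin d → ℕ) → (Fin d → ℕ) → ℝ := fun m l => ∏ i, (2 * q ^ 2) ^ m i / 2 ^ l i
  have hQ0 : ∀ m l, 0 ≤ Q m l := fun m l => Finset.prod_nonneg fun i _ => by positivity
  let T : (Fin d → ℕ) → (Fin d → ℕ) → ℕ := fun m l => ⌈K₀ * (1 + Q m l)⌉₊
  let U : ∀ l : Fin d → ℕ, (∀ i, Fin (2 ^ l i)) → Set (Fin d → UnitAddCircle) :=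
    fun l g => torusBox (gridPoint l g) fun i => 2 * 2⁻¹ ^ l i
  let Λ : (Fin d → ℕ) → Finset (Fin d → ℕ) := fun m =>
    Fintype.piFinset fun i => Finset.range (m i + 1)
  let E : (Fin d → ℕ) → Set Ω := fun m => ⋃ l ∈ Λ m,
    ⋃ g ∈ (Finset.univ : Finset (∀ i, Fin (2 ^ l i))),
      {ω | ∃ J ∈ (S m).powersetCard (T m l), ∀ n ∈ J, θ n ω ∈ U l g}
  have hsingle : ∀ m l g, P {ω | ∃ J ∈ (S m).powersetCard (T m l), ∀ n ∈ J, θ n ω ∈ U l g} ≤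
      ENNReal.ofReal (∏ i, 4⁻¹ ^ m i) := by
    intro m l g
    exact measure_crowded_box_le hlaw hindep hq0 hq1 hT₀.le (le_max_left _ _)
      (le_max_right _ _) m l (S m) (hS m) (Nat.le_ceil _) _
  have hE : ∀ m, P (E m) ≤ ENNReal.ofReal (∏ i, 2 * 2⁻¹ ^ m i) := by
    intro m
    calc P (E m) ≤ ∑ l ∈ Λ m, ∑ g ∈ (Finset.univ : Finset (∀ i, Fin (2 ^ l i))),
          P {ω | ∃ J ∈ (S m).powersetCard (T m l), ∀ n ∈ J, θ n ω ∈ U l g} :=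
          (measure_biUnion_finset_le _ _).trans
            (Finset.sum_le_sum fun l _ => measure_biUnion_finset_le _ _)
      _ ≤ ∑ l ∈ Λ m, ∑ g ∈ (Finset.univ : Finset (∀ i, Fin (2 ^ l i))),
          ENNReal.ofReal (∏ i, 4⁻¹ ^ m i) :=
          Finset.sum_le_sum fun l _ => Finset.sum_le_sum fun g _ => hsingle m l g
      _ = ENNReal.ofReal ((∑ l ∈ Λ m, ∏ i, (2 : ℝ) ^ l i) * ∏ i, 4⁻¹ ^ m i) := by
          rw [Finset.sum_mul, ENNReal.ofReal_sum_of_nonneg fun l _ => by positivity]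
          refine Finset.sum_congr rfl fun l _ => ?_
          rw [Finset.sum_const, Finset.card_univ, Fintype.card_pi, nsmul_eq_mul,
            ENNReal.ofReal_mul (by positivity), ← ENNReal.ofReal_natCast]
          simp
      _ ≤ _ := by
          refine ENNReal.ofReal_le_ofReal ?_
          rw [← Finset.prod_univ_sum, ← Finset.prod_mul_distrib]
          refine Finset.prod_le_prod (fun i _ => by positivity) fun i _ => ?_
          calc _ ≤ 2 * (2 : ℝ) ^ m i * 4⁻¹ ^ m i := by
                gcongr
                exact sum_two_pow_range_le _
            _ = _ := by
                rw [mul_assoc, ← mul_pow]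
                norm_num
  have hsum : ∑' m, P (E m) ≠ ∞ := by
    refine ne_of_lt (lt_of_le_of_lt (b := ENNReal.ofReal ((2 * (1 - 2⁻¹)⁻¹) ^ d)) ?_
      ENNReal.ofReal_lt_top)
    refine ENNReal.summable.tsum_le_of_sum_le fun I => ?_
    refine (Finset.sum_le_sum fun m _ => hE m).trans ?_
    rw [← ENNReal.ofReal_sum_of_nonneg fun m _ => by positivity]
    refine ENNReal.ofReal_le_ofReal (sum_prod_le I (fun _ k => 2 * 2⁻¹ ^ k)
      (fun i k => by positivity) fun i s => ?_)
    rw [← Finset.mul_sum]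
    exact mul_le_mul_of_nonneg_left
      (sum_pow_le_of_injOn (by norm_num) (by norm_num) s id Function.injective_id.injOn)
      zero_le_two
  filter_upwards [ae_finite_setOfPred_mem hsum] with ω hω
  set K₁ : ℝ := ∑ m ∈ hω.toFinset, ((S m).card : ℝ) with hK₁
  have hK₁0 : 0 ≤ K₁ := Finset.sum_nonneg fun _ _ => by positivity
  refine ⟨K₀ + K₁, add_nonneg hK₀0 hK₁0, fun m l hl c J hJS hJ => ?_⟩
  change (J.card : ℝ) ≤ (K₀ + K₁) * (1 + Q m l)
  have hQ := hQ0 m l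
  by_cases hm : ω ∈ E m
  · have h1 : ((S m).card : ℝ) ≤ K₁ :=
      Finset.single_le_sum (f := fun m => ((S m).card : ℝ)) (fun _ _ => by positivity)
        (hω.mem_toFinset.2 hm)
    have h2 : (J.card : ℝ) ≤ (S m).card := by exact_mod_cast Finset.card_le_card hJS
    nlinarith [mul_nonneg (add_nonneg hK₀0 hK₁0) hQ]
  · have h3 : J.card < T m l := by
      by_contra hcon
      obtain ⟨J', hJ'J, hJ'⟩ := Finset.exists_subset_card_eq (not_lt.1 hcon)
      obtain ⟨g, hg⟩ := exists_mem_torusBox_gridPoint l c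
      refine hm ?_
      simp only [E, Set.mem_iUnion]
      refine ⟨l, Fintype.mem_piFinset.2 fun i => Finset.mem_range.2 (Nat.lt_succ_of_le (hl i)), g,
        Finset.mem_univ _, J', Finset.mem_powersetCard.2 ⟨hJ'J.trans hJS, hJ'⟩, fun n hn i => ?_⟩
      have h4 := hJ n (hJ'J hn) i
      have h5 := hg i
      have h6 := norm_add_le (gridPoint l g i - c i) (c i - θ n ω i)
      rw [sub_add_sub_cancel] at h6
      have h7 : (2 : ℝ)⁻¹ ^ (l i + 1) ≤ 2⁻¹ ^ l i :=
        pow_le_pow_of_le_one (by norm_num) (by norm_num) (Nat.le_succ _)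
      linarith
    have h8 := Nat.lt_ceil.1 h3
    nlinarith [mul_nonneg hK₁0 (show 0 ≤ 1 + Q m l by linarith)]

end Torus

/-! ### Clusters of random points -/

section Counting

variable {α β : Type*} [Fintype α] [DecidableEq α] [Fintype β] [DecidableEq β]

/-- The maps that send `A` to `S` with all fibres over `S` of size less than `j`, and everything
outside `A` to `b₀`. -/
def smallFibreMaps (j : ℕ) (b₀ : β) (A : Finset α) (S : Finset β) : Finset (α → β) :=
  Finset.univ.filter fun f => (∀ a ∈ A, f a ∈ S) ∧ (∀ a ∉ A, f a = b₀) ∧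
    ∀ b ∈ S, (A.filter fun a => f a = b).card < j

theorem card_smallFibreMaps_insert_le (j : ℕ) (b₀ : β) (A : Finset α) {S : Finset β} {b : β} :
    (smallFibreMaps j b₀ A (insert b S)).card ≤
      ∑ T ∈ A.powerset.filter (fun T => T.card < j), (smallFibreMaps j b₀ (A \ T) S).card := by
  have hsub : smallFibreMaps j b₀ A (insert b S) ⊆
      (A.powerset.filter fun T => T.card < j).biUnion fun T =>
        (smallFibreMaps j b₀ (A \ T) S).image fun f a => if a ∈ T then b else f a := by
    intro f hf
    obtain ⟨h1, h2, h3⟩ := (Finset.mem_filter.1 hf).2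
    refine Finset.mem_biUnion.2 ⟨A.filter fun a => f a = b, ?_, ?_⟩
    · exact Finset.mem_filter.2 ⟨Finset.mem_powerset.2 (Finset.filter_subset _ _),
        h3 b (Finset.mem_insert_self _ _)⟩
    · refine Finset.mem_image.2 ⟨fun a => if a ∈ A ∧ f a = b then b₀ else f a, ?_, ?_⟩
      · refine Finset.mem_filter.2 ⟨Finset.mem_univ _, fun a ha => ?_, fun a ha => ?_,
          fun c hc => ?_⟩
        · simp only [Finset.mem_sdiff, Finset.mem_filter, not_and] at ha
          have hab := ha.2 ha.1
          show (if a ∈ A ∧ f a = b then b₀ else f a) ∈ S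
          rw [if_neg fun h => hab h.2]
          exact (Finset.mem_insert.1 (h1 a ha.1)).resolve_left hab
        · simp only [Finset.mem_sdiff, Finset.mem_filter, not_and, not_forall, not_not,
            exists_prop] at ha
          show (if a ∈ A ∧ f a = b then b₀ else f a) = b₀
          split_ifs with h
          · rfl
          · refine h2 a fun haA => h ⟨haA, (ha haA).2⟩
        · refine lt_of_le_of_lt (Finset.card_le_card fun a ha => ?_)
            (h3 c (Finset.mem_insert_of_mem hc))
          simp only [Finset.mem_sdiff, Finset.mem_filter, not_and] at ha ⊢
          obtain ⟨⟨haA, hab⟩, hac⟩ := ha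
          rw [if_neg fun h => hab haA h.2] at hac
          exact ⟨haA, hac⟩
      · funext a
        simp only [Finset.mem_filter]
        split_ifs with h
        · exact h.2.symm
        · rfl
  calc _ ≤ _ := Finset.card_le_card hsub
    _ ≤ _ := Finset.card_biUnion_le
    _ ≤ _ := Finset.sum_le_sum fun T _ => Finset.card_image_le

/-- The coefficient bound `#{f : A → S with fibres < j} ≤ |A|! x^{-|A|} (∑_{i < j} x^i / i!)^{|S|}`
for the exponential generating function of the maps with small fibres. -/
theorem card_smallFibreMaps_mul_pow_le (j : ℕ) (b₀ : β) {x : ℝ} (hx : 0 ≤ x) (S : Finset β) :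
    ∀ A : Finset α, ((smallFibreMaps j b₀ A S).card : ℝ) * x ^ A.card ≤
      A.card.factorial * (∑ i ∈ Finset.range j, x ^ i / i.factorial) ^ S.card := by
  induction S using Finset.induction_on with
  | empty =>
    intro A
    rcases A.eq_empty_or_nonempty with rfl | ⟨a, ha⟩
    · have h : (smallFibreMaps j b₀ (∅ : Finset α) ∅).card ≤ 1 := by
        refine Finset.card_le_one.2 fun f hf g hg => ?_
        funext a
        rw [(Finset.mem_filter.1 hf).2.2.1 a (Finset.notMem_empty a),
          (Finset.mem_filter.1 hg).2.2.1 a (Finset.notMem_empty a)]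
      simpa using h
    · have h : smallFibreMaps j b₀ A (∅ : Finset β) = ∅ := by
        refine Finset.eq_empty_of_forall_notMem fun f hf => ?_
        exact Finset.notMem_empty _ ((Finset.mem_filter.1 hf).2.1 a ha)
      rw [h]
      simp
  | insert b S hb ih =>
    intro A
    set E : ℝ := ∑ i ∈ Finset.range j, x ^ i / i.factorial with hE
    have hE0 : 0 ≤ E := Finset.sum_nonneg fun i _ => by positivity
    have h1 : ((smallFibreMaps j b₀ A (insert b S)).card : ℝ) * x ^ A.card ≤
        ∑ T ∈ A.powerset, if T.card < j then
          x ^ T.card * ((A.card - T.card).factorial * E ^ S.card) else 0 := by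
      rw [← Finset.sum_filter]
      calc _ ≤ ((∑ T ∈ A.powerset.filter (fun T => T.card < j),
            (smallFibreMaps j b₀ (A \ T) S).card : ℕ) : ℝ) * x ^ A.card := by
            gcongr
            exact card_smallFibreMaps_insert_le j b₀ A
        _ = ∑ T ∈ A.powerset.filter (fun T => T.card < j),
            x ^ T.card * ((smallFibreMaps j b₀ (A \ T) S).card * x ^ (A \ T).card) := by
            rw [Nat.cast_sum, Finset.sum_mul]
            refine Finset.sum_congr rfl fun T hT => ?_
            have hTA := Finset.mem_powerset.1 (Finset.mem_filter.1 hT).1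
            rw [← Finset.card_sdiff_add_card_eq_card hTA, pow_add]
            ring
        _ ≤ _ := by
            refine Finset.sum_le_sum fun T hT => ?_
            have hTA := Finset.mem_powerset.1 (Finset.mem_filter.1 hT).1
            rw [← Finset.card_sdiff_of_subset hTA]
            exact mul_le_mul_of_nonneg_left (ih (A \ T)) (by positivity)
    refine h1.trans ?_
    rw [Finset.sum_powerset_apply_card (fun i => if i < j then
      x ^ i * ((A.card - i).factorial * E ^ S.card) else 0), Finset.card_insert_of_notMem hb]
    have h2 : ∀ i ∈ Finset.range (A.card + 1), A.card.choose i • (if i < j then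
        x ^ i * ((A.card - i).factorial * E ^ S.card) else 0) =
        if i < j then (A.card.factorial * E ^ S.card) * (x ^ i / i.factorial) else 0 := by
      intro i hi
      split_ifs with hij
      · rw [← Nat.choose_mul_factorial_mul_factorial (Nat.lt_succ_iff.1 (Finset.mem_range.1 hi)),
          nsmul_eq_mul]
        push_cast
        have : (i.factorial : ℝ) ≠ 0 := by positivity
        field_simp
      · simp
    rw [Finset.sum_congr rfl h2, ← Finset.sum_filter, ← Finset.mul_sum, pow_succ, ← mul_assoc]
    refine mul_le_mul_of_nonneg_left ?_ (by positivity)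
    refine Finset.sum_le_sum_of_subset_of_nonneg (fun i hi => ?_) fun i _ _ => by positivity
    exact Finset.mem_range.2 (Finset.mem_filter.1 hi).2

end Counting

section Poisson

/-- The easy half of Stirling's formula, with a linear loss. -/
theorem factorial_mul_exp_le {n : ℕ} (hn : 1 ≤ n) :
    (n.factorial : ℝ) * Real.exp n ≤ Real.exp 1 * n * (n : ℝ) ^ n := by
  induction n, hn using Nat.le_induction with
  | base => simp
  | succ n hn ih =>
    have hn0 : (0 : ℝ) < n := by exact_mod_cast hn
    -- `e ≤ (1 + 1/n)^(n+1)`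
    have h1 : Real.exp 1 * (n : ℝ) ^ (n + 1) ≤ ((n : ℝ) + 1) ^ (n + 1) := by
      have h2 : (n : ℝ) / (n + 1) ≤ Real.exp (-(1 / ((n : ℝ) + 1))) := by
        have := Real.add_one_le_exp (-(1 / ((n : ℝ) + 1)))
        refine le_trans (le_of_eq ?_) this
        field_simp
        ring
      have h3 := pow_le_pow_left₀ (by positivity) h2 (n + 1)
      rw [← Real.exp_nat_mul, div_pow, div_le_iff₀ (by positivity)] at h3
      have e : ((n + 1 : ℕ) : ℝ) * -(1 / ((n : ℝ) + 1)) = -1 := by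
        push_cast
        field_simp
      rw [e] at h3
      calc _ ≤ Real.exp 1 * (Real.exp (-1) * ((n : ℝ) + 1) ^ (n + 1)) := by gcongr
        _ = _ := by rw [← mul_assoc, ← Real.exp_add]; simp
    rw [Nat.factorial_succ]
    push_cast
    rw [Real.exp_add]
    calc ((n : ℝ) + 1) * n.factorial * (Real.exp n * Real.exp 1)
        = ((n : ℝ) + 1) * Real.exp 1 * (n.factorial * Real.exp n) := by ring
      _ ≤ ((n : ℝ) + 1) * Real.exp 1 * (Real.exp 1 * n * (n : ℝ) ^ n) := by gcongr
      _ = ((n : ℝ) + 1) * Real.exp 1 * (Real.exp 1 * (n : ℝ) ^ (n + 1)) := by ring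
      _ ≤ ((n : ℝ) + 1) * Real.exp 1 * ((n : ℝ) + 1) ^ (n + 1) := by gcongr
      _ = _ := by ring

/-- For `x ≤ 1`, a Poisson variable of mean `x` is at least `j` with probability at least
`x^j / (3 j!)`. -/
theorem sum_pow_div_factorial_le_exp {x : ℝ} (hx : 0 ≤ x) (hx1 : x ≤ 1) (j : ℕ) :
    ∑ i ∈ Finset.range j, x ^ i / i.factorial ≤ Real.exp (x - x ^ j / (3 * j.factorial)) := by
  have h1 := Real.sum_le_exp_of_nonneg hx (j + 1)
  rw [Finset.sum_range_succ] at h1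
  have h2 : Real.exp x ≤ 3 := (Real.exp_le_exp.2 hx1).trans (by linarith [Real.exp_one_lt_d9])
  have h3 := Real.add_one_le_exp (-(x ^ j / (3 * j.factorial)))
  rw [sub_eq_add_neg, Real.exp_add]
  have h4 : Real.exp x * (x ^ j / (3 * j.factorial)) ≤ x ^ j / j.factorial := by
    calc _ ≤ 3 * (x ^ j / (3 * j.factorial)) := by gcongr
      _ = _ := by field_simp
  nlinarith [Real.exp_pos x]

end Poisson

section Clusters

variable {d : ℕ} {Ω : Type*} [MeasurableSpace Ω] {P : Measure Ω}
  {θ : ℕ → Ω → Fin d → UnitAddCircle}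

/-- If the torus is covered by boxes of measure at most `1 / |B|`, then the probability that `N`
random points leave fewer than `j` of them in each box is at most `e N exp(-|B| x^j / (3 j!))`
with `x = N / |B|`. -/
theorem measure_forall_card_lt_le (hlaw : ∀ n, HasLaw (θ n) (torusMeasure d) P)
    (hindep : iIndepFun θ P) {B : Type*} [Fintype B] [Nonempty B]
    (U : B → Set (Fin d → UnitAddCircle)) (hU : ∀ b, MeasurableSet (U b))
    (hcover : ∀ x, ∃ b, x ∈ U b)
    (hp : ∀ b, torusMeasure d (U b) ≤ ENNReal.ofReal ((Fintype.card B : ℝ)⁻¹))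
    (A : Finset ℕ) (hA : 1 ≤ A.card) (hAB : A.card ≤ Fintype.card B) (j : ℕ) :
    P {ω | ∀ b, ∀ J ⊆ A, (∀ n ∈ J, θ n ω ∈ U b) → J.card < j} ≤
      ENNReal.ofReal (Real.exp 1 * A.card * Real.exp (-(Fintype.card B *
        (A.card / Fintype.card B) ^ j / (3 * j.factorial)))) := by
  classical
  obtain ⟨b₀⟩ := ‹Nonempty B›
  set N := A.card with hN
  set M := Fintype.card B with hM
  have hN0 : (0 : ℝ) < N := by exact_mod_cast hA
  have hM0 : (0 : ℝ) < M := by exact_mod_cast (lt_of_lt_of_le hA hAB)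
  set G : Finset (A → B) := smallFibreMaps j b₀ Finset.univ Finset.univ with hG
  have hsub : {ω | ∀ b, ∀ J ⊆ A, (∀ n ∈ J, θ n ω ∈ U b) → J.card < j} ⊆
      ⋃ f ∈ G, {ω | ∀ n ∈ A, θ n ω ∈ if h : n ∈ A then U (f ⟨n, h⟩) else Set.univ} := by
    intro ω hω
    choose f hf using fun n : A => hcover (θ n ω)
    simp only [Set.mem_iUnion]
    refine ⟨f, Finset.mem_filter.2 ⟨Finset.mem_univ _, fun _ _ => Finset.mem_univ _,
      fun a ha => absurd (Finset.mem_univ a) ha, fun b _ => ?_⟩, fun n hn => ?_⟩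
    · have h := hω b ((Finset.univ.filter fun a : A => f a = b).map (Function.Embedding.subtype _))
        (fun n hn => ?_) (fun n hn => ?_)
      · rwa [Finset.card_map] at h
      · obtain ⟨a, -, rfl⟩ := Finset.mem_map.1 hn
        exact a.2
      · obtain ⟨a, ha, rfl⟩ := Finset.mem_map.1 hn
        rw [← (Finset.mem_filter.1 ha).2]
        exact hf a
    · rw [dif_pos hn]
      exact hf ⟨n, hn⟩
  have hcount := card_smallFibreMaps_mul_pow_le (α := A) j b₀
    (show (0 : ℝ) ≤ N / M by positivity) (Finset.univ : Finset B) Finset.univ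
  rw [← hG, Finset.card_univ, Finset.card_univ, Fintype.card_coe, ← hN, ← hM] at hcount
  have hx1 : (N : ℝ) / M ≤ 1 := by
    rw [div_le_one hM0]
    exact_mod_cast hAB
  have hE := pow_le_pow_left₀ (Finset.sum_nonneg fun i _ => by positivity)
    (sum_pow_div_factorial_le_exp (show (0 : ℝ) ≤ N / M by positivity) hx1 j) M
  rw [← Real.exp_nat_mul] at hE
  have e : (M : ℝ) * ((N : ℝ) / M - ((N : ℝ) / M) ^ j / (3 * j.factorial)) =
      N + -(M * ((N : ℝ) / M) ^ j / (3 * j.factorial)) := by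
    field_simp
    ring
  rw [e, Real.exp_add] at hE
  set X := Real.exp (-(M * ((N : ℝ) / M) ^ j / (3 * j.factorial)))
  calc _ ≤ P (⋃ f ∈ G, {ω | ∀ n ∈ A, θ n ω ∈ if h : n ∈ A then U (f ⟨n, h⟩) else Set.univ}) :=
        measure_mono hsub
    _ ≤ ∑ f ∈ G, P {ω | ∀ n ∈ A, θ n ω ∈ if h : n ∈ A then U (f ⟨n, h⟩) else Set.univ} :=
        measure_biUnion_finset_le _ _
    _ ≤ ∑ f ∈ G, ENNReal.ofReal ((M : ℝ)⁻¹) ^ N := by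
        refine Finset.sum_le_sum fun f _ => measure_forall_mem_le hlaw hindep A _
          (fun n hn => ?_) fun n hn => ?_
        · rw [dif_pos hn]
          exact hU _
        · rw [dif_pos hn]
          exact hp _
    _ = ENNReal.ofReal (G.card * ((M : ℝ)⁻¹) ^ N) := by
        rw [Finset.sum_const, nsmul_eq_mul, ENNReal.ofReal_mul (by positivity),
          ENNReal.ofReal_natCast, ENNReal.ofReal_pow (by positivity)]
    _ ≤ _ := by
        refine ENNReal.ofReal_le_ofReal ?_
        have h1 : (G.card : ℝ) * ((M : ℝ)⁻¹) ^ N * (N : ℝ) ^ N ≤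
            (Real.exp 1 * N * X) * (N : ℝ) ^ N := by
          calc _ = (G.card : ℝ) * ((N : ℝ) / M) ^ N := by
                rw [div_eq_mul_inv, mul_pow]
                ring
            _ ≤ _ := hcount
            _ ≤ N.factorial * (Real.exp N * X) := by gcongr
            _ = N.factorial * Real.exp N * X := by ring
            _ ≤ Real.exp 1 * N * (N : ℝ) ^ N * X := by
                exact mul_le_mul_of_nonneg_right (factorial_mul_exp_le hA) (Real.exp_pos _).le
            _ = _ := by ring
        exact le_of_mul_le_mul_right h1 (by positivity)

end Clusters

section RandomClusters

/-- If `N ≥ M^{1 - 1/(2j)}` points are thrown into `M` boxes, the expected number of boxes with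
`j` points is of order at least `√M`, so that the bound for the probability of having none is
`O(1/M)`. -/
theorem exp_neg_cluster_le {N M : ℝ} (hM : 1 ≤ M) (hNM : N ≤ M) {j : ℕ} (hj : j ≠ 0)
    (hN : M ^ (1 - 1 / (2 * (j : ℝ))) ≤ N) :
    Real.exp 1 * N * Real.exp (-(M * (N / M) ^ j / (3 * j.factorial))) ≤
      Real.exp 1 * 24 * (3 * j.factorial) ^ 4 / M := by
  have hM0 : 0 < M := by linarith
  have hj0 : (j : ℝ) ≠ 0 := by exact_mod_cast hj
  set F : ℝ := 3 * j.factorial with hF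
  have hF0 : 0 < F := by positivity
  have h1 : √M ≤ M * (N / M) ^ j := by
    have h2 : M ^ (-(1 / (2 * (j : ℝ)))) ≤ N / M := by
      rw [le_div_iff₀ hM0]
      refine le_trans (le_of_eq ?_) hN
      rw [sub_eq_neg_add, Real.rpow_add hM0, Real.rpow_one]
    have h3 := pow_le_pow_left₀ (by positivity) h2 j
    rw [← Real.rpow_natCast, ← Real.rpow_mul hM0.le] at h3
    have e : -(1 / (2 * (j : ℝ))) * j = -(1 / 2) := by field_simp
    rw [e] at h3
    calc √M = M * M ^ (-(1 / 2) : ℝ) := by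
          rw [Real.sqrt_eq_rpow, ← Real.rpow_one_add' hM0.le (by norm_num)]
          norm_num
      _ ≤ _ := by gcongr
  have hs : 0 < √M := Real.sqrt_pos.2 hM0
  have h4 : Real.exp (-(M * (N / M) ^ j / F)) ≤ 24 * F ^ 4 / M ^ 2 := by
    have h5 : Real.exp (-(M * (N / M) ^ j / F)) ≤ (Real.exp (√M / F))⁻¹ := by
      rw [← Real.exp_neg]
      gcongr
    refine h5.trans ?_
    have h6 := Real.pow_div_factorial_le_exp (√M / F) (by positivity) 4
    have h7 : (√M / F) ^ 4 / (Nat.factorial 4 : ℕ) = M ^ 2 / (24 * F ^ 4) := by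
      rw [div_pow, show √M ^ 4 = (√M ^ 2) ^ 2 by ring, Real.sq_sqrt hM0.le, div_div,
        mul_comm]
      norm_num [Nat.factorial]
    rw [h7] at h6
    rw [← inv_div (M ^ 2)]
    exact inv_anti₀ (by positivity) h6
  calc _ ≤ Real.exp 1 * M * (24 * F ^ 4 / M ^ 2) := by gcongr
    _ = _ := by field_simp

variable {d : ℕ} {Ω : Type*} [MeasurableSpace Ω] {P : Measure Ω}
  {θ : ℕ → Ω → Fin d → UnitAddCircle}

theorem measure_no_cluster_le (hlaw : ∀ n, HasLaw (θ n) (torusMeasure d) P)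
    (hindep : iIndepFun θ P) {S : Set ℕ} (m : Fin d → ℕ) {j : ℕ} (hj : j ≠ 0)
    (hS : ENNReal.ofReal ((2 : ℝ) ^ ((1 - 1 / (2 * (j : ℝ))) * ((∑ i, m i : ℕ) : ℝ))) ≤
      (S.encard : ℝ≥0∞)) :
    P {ω | ∀ b (J : Finset ℕ), (J : Set ℕ) ⊆ S →
        (∀ n ∈ J, θ n ω ∈ torusBox (gridPoint m b) fun i => 2⁻¹ ^ (m i + 1)) → J.card < j} ≤
      ENNReal.ofReal (Real.exp 1 * 24 * (3 * j.factorial) ^ 4 * 2⁻¹ ^ (∑ i, m i)) := by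
  set M : ℝ := 2 ^ (∑ i, m i) with hM
  have hM1 : 1 ≤ M := one_le_pow₀ one_le_two
  have hcard : (Fintype.card (∀ i, Fin (2 ^ m i)) : ℝ) = M := by
    rw [Fintype.card_pi]
    simp [hM, Finset.prod_pow_eq_pow_sum]
  have hj1 : (1 : ℝ) ≤ j := by exact_mod_cast Nat.one_le_iff_ne_zero.2 hj
  have hexp : (1 : ℝ) - 1 / (2 * (j : ℝ)) ≤ 1 := by
    have : (0 : ℝ) ≤ 1 / (2 * (j : ℝ)) := by positivity
    linarith
  have hpow : (2 : ℝ) ^ ((1 - 1 / (2 * (j : ℝ))) * ((∑ i, m i : ℕ) : ℝ)) =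
      M ^ (1 - 1 / (2 * (j : ℝ))) := by
    rw [mul_comm, Real.rpow_mul zero_le_two, Real.rpow_natCast]
  set N : ℕ := ⌈M ^ (1 - 1 / (2 * (j : ℝ)))⌉₊ with hN
  have hNS : (N : ℕ∞) ≤ S.encard := by
    rw [hpow] at hS
    induction h : S.encard with
    | top => exact le_top
    | coe k =>
      rw [h, ENat.toENNReal_coe, ENNReal.ofReal_le_natCast] at hS
      exact Nat.cast_le.2 (Nat.ceil_le.2 hS)
  obtain ⟨A', hA'S, hA'⟩ := Set.exists_subset_encard_eq hNS
  have hfin : A'.Finite := Set.finite_of_encard_eq_coe hA'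
  lift A' to Finset ℕ using hfin
  rw [Set.encard_coe_eq_coe_finsetCard, Nat.cast_inj] at hA'
  have hN1 : 1 ≤ N := Nat.one_le_ceil_iff.2 (by positivity)
  have hNM : N ≤ Fintype.card (∀ i, Fin (2 ^ m i)) := by
    refine Nat.ceil_le.2 ?_
    rw [hcard]
    calc _ ≤ M ^ (1 : ℝ) := Real.rpow_le_rpow_of_exponent_le hM1 hexp
      _ = M := Real.rpow_one M
  have h := measure_forall_card_lt_le hlaw hindep
    (fun b : ∀ i, Fin (2 ^ m i) => torusBox (gridPoint m b) fun i => 2⁻¹ ^ (m i + 1))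
    (fun b => measurableSet_torusBox _ _) (exists_mem_torusBox_gridPoint m)
    (fun b => ?_) A' (hA' ▸ hN1) (hA' ▸ hNM) j
  · refine (measure_mono fun ω hω b J hJ hb => ?_).trans (h.trans (ENNReal.ofReal_le_ofReal ?_))
    · exact hω b J ((Finset.coe_subset.2 hJ).trans hA'S) hb
    · rw [hA', hcard]
      refine (exp_neg_cluster_le hM1 ?_ hj (Nat.le_ceil _)).trans (le_of_eq ?_)
      · exact (Nat.cast_le.2 hNM).trans_eq hcard
      · rw [inv_pow, div_eq_mul_inv]
  · refine (torusMeasure_torusBox_le _ _ fun i => by positivity).trans (le_of_eq ?_)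
    rw [hcard, hM, ← inv_pow, ← Finset.prod_pow_eq_pow_sum]
    congr 1
    refine Finset.prod_congr rfl fun i _ => ?_
    rw [pow_succ]
    ring

/-- If the counts of the sets `S m` do not satisfy any bound `C 2^{(1-ε)|m|}`, then almost surely
arbitrarily many of the points of some `S m` lie in one box of side lengths `2^{-m i}`. -/
theorem ae_exists_cluster (hlaw : ∀ n, HasLaw (θ n) (torusMeasure d) P)
    (hindep : iIndepFun θ P) (S : (Fin d → ℕ) → Set ℕ)
    (hS : ¬ ∃ ε C : ℝ, 0 < ε ∧ 0 < C ∧ ∀ m : Fin d → ℕ,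
      ((S m).encard : ℝ≥0∞) ≤ ENNReal.ofReal (C * (2 : ℝ) ^ ((1 - ε) * ((∑ i, m i : ℕ) : ℝ)))) :
    ∀ᵐ ω ∂P, ∀ j : ℕ, ∃ m b, ∃ J : Finset ℕ, (J : Set ℕ) ⊆ S m ∧
      (∀ n ∈ J, θ n ω ∈ torusBox (gridPoint m b) fun i => 2⁻¹ ^ (m i + 1)) ∧ j ≤ J.card := by
  classical
  rw [ae_all_iff]
  intro j
  rcases eq_or_ne j 0 with rfl | hj
  · exact Filter.Eventually.of_forall fun ω =>
      ⟨0, fun _ => ⟨0, by simp⟩, ∅, by simp, by simp, le_rfl⟩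
  by_cases hinf : ∃ m, (S m).Infinite
  · obtain ⟨m, hm⟩ := hinf
    refine Filter.Eventually.of_forall fun ω => ?_
    choose g hg using fun n => exists_mem_torusBox_gridPoint m (θ n ω)
    obtain ⟨A, hAS, hA⟩ := hm.exists_subset_card_eq (Fintype.card (∀ i, Fin (2 ^ m i)) * j)
    obtain ⟨b, -, hb⟩ := Finset.exists_le_card_fiber_of_mul_le_card_of_maps_to (s := A)
      (t := Finset.univ) (f := g) (n := j) (fun _ _ => Finset.mem_univ _)
      ⟨fun _ => ⟨0, by simp⟩, Finset.mem_univ _⟩ (by rw [Finset.card_univ, hA])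
    refine ⟨m, b, A.filter fun n => g n = b, ?_, fun n hn => ?_, hb⟩
    · exact (Finset.coe_subset.2 (Finset.filter_subset _ _)).trans hAS
    · rw [← (Finset.mem_filter.1 hn).2]
      exact hg n
  · simp only [not_exists, Set.not_infinite] at hinf
    have hj1 : (1 : ℝ) ≤ j := by exact_mod_cast Nat.one_le_iff_ne_zero.2 hj
    have hε : (0 : ℝ) < 1 / (2 * (j : ℝ)) := by positivity
    have hε1 : 1 / (2 * (j : ℝ)) ≤ 1 := by
      rw [div_le_one (by positivity)]
      linarith
    have hlarge : ∀ L : ℕ, ∃ m : Fin d → ℕ, L ≤ ∑ i, m i ∧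
        ENNReal.ofReal ((2 : ℝ) ^ ((1 - 1 / (2 * (j : ℝ))) * ((∑ i, m i : ℕ) : ℝ))) ≤
          ((S m).encard : ℝ≥0∞) := by
      intro L
      -- the constant `C` exceeds all counts with `|m| < L`
      set C : ℝ := 1 + ∑ m ∈ Fintype.piFinset fun _ : Fin d => Finset.range L,
        ((hinf m).toFinset.card : ℝ) with hC
      have hC1 : 1 ≤ C := le_add_of_nonneg_right (Finset.sum_nonneg fun _ _ => by positivity)
      have hex : ∃ m : Fin d → ℕ, ENNReal.ofReal (C *
          (2 : ℝ) ^ ((1 - 1 / (2 * (j : ℝ))) * ((∑ i, m i : ℕ) : ℝ))) <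
            ((S m).encard : ℝ≥0∞) := by
        by_contra hcon
        push Not at hcon
        exact hS ⟨_, C, hε, by linarith, hcon⟩
      obtain ⟨m, hm⟩ := hex
      have hone : (1 : ℝ) ≤ (2 : ℝ) ^ ((1 - 1 / (2 * (j : ℝ))) * ((∑ i, m i : ℕ) : ℝ)) :=
        Real.one_le_rpow one_le_two (mul_nonneg (by linarith) (Nat.cast_nonneg _))
      refine ⟨m, ?_, le_trans (ENNReal.ofReal_le_ofReal ?_) hm.le⟩
      · by_contra hL
        have hmem : m ∈ Fintype.piFinset fun _ : Fin d => Finset.range L :=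
          Fintype.mem_piFinset.2 fun i => Finset.mem_range.2
            ((Finset.single_le_sum (f := m) (fun _ _ => Nat.zero_le _)
              (Finset.mem_univ i)).trans_lt (not_le.1 hL))
        have h1 := Finset.single_le_sum
          (f := fun m : Fin d → ℕ => ((hinf m).toFinset.card : ℝ))
          (fun _ _ => Nat.cast_nonneg _) hmem
        rw [(hinf m).encard_eq_coe_toFinset_card, ENat.toENNReal_coe,
          ENNReal.ofReal_lt_natCast (by rintro h0; simp [h0] at hm)] at hm
        nlinarith
      · exact le_mul_of_one_le_left (by positivity) hC1
    rw [ae_iff]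
    set K : ℝ := Real.exp 1 * 24 * (3 * j.factorial) ^ 4
    have hbound : ∀ L : ℕ, P {ω | ¬ ∃ m b, ∃ J : Finset ℕ, (J : Set ℕ) ⊆ S m ∧
        (∀ n ∈ J, θ n ω ∈ torusBox (gridPoint m b) fun i => 2⁻¹ ^ (m i + 1)) ∧ j ≤ J.card} ≤
          ENNReal.ofReal (K * 2⁻¹ ^ L) := by
      intro L
      obtain ⟨m, hmL, hm⟩ := hlarge L
      refine (measure_mono fun ω hω => ?_).trans
        ((measure_no_cluster_le hlaw hindep m hj hm).trans (ENNReal.ofReal_le_ofReal ?_))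
      · intro b J hJ hb
        by_contra hcard
        exact hω ⟨m, b, J, hJ, hb, not_lt.1 hcard⟩
      · refine mul_le_mul_of_nonneg_left ?_ (by positivity)
        exact pow_le_pow_of_le_one (by norm_num) (by norm_num) hmL
    have hlim : Filter.Tendsto (fun L : ℕ => ENNReal.ofReal (K * 2⁻¹ ^ L)) Filter.atTop
        (nhds 0) := by
      have h := (tendsto_pow_atTop_nhds_zero_of_lt_one (r := (2 : ℝ)⁻¹) (by norm_num)
        (by norm_num)).const_mul K
      have h' := ENNReal.tendsto_ofReal h
      simpa using h'
    exact le_antisymm (ge_of_tendsto' hlim hbound) (zero_le)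

end RandomClusters

/-! ### The dichotomy -/

section Dichotomy

theorem exists_mem_dyadicRadii {x : ℝ} (hx0 : 0 ≤ x) (hx1 : x < 1) : ∃ k, x ∈ dyadicRadii k := by
  obtain ⟨n, h1, h2⟩ := exists_nat_pow_near_of_lt_one (x := 1 - x) (y := (2 : ℝ)⁻¹) (by linarith)
    (by linarith) (by norm_num) (by norm_num)
  rcases h2.lt_or_eq with h | h
  · exact ⟨n, h1.le, Or.inr h⟩
  · cases n with
    | zero => exact ⟨0, h1.le, Or.inl rfl⟩
    | succ n =>
      exact ⟨n, h.ge, Or.inr (h.trans_lt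
        (pow_lt_pow_right_of_lt_one₀ (by norm_num) (by norm_num) n.lt_succ_self))⟩

variable {d : ℕ} {Ω : Type*} [MeasurableSpace Ω] {P : Measure Ω}
  {r : ℕ → Fin d → Set.Ico (0 : ℝ) 1} {θ : ℕ → Ω → Fin d → UnitAddCircle}

theorem ae_isCarlesonSequence_of_count_le (hlaw : ∀ n, HasLaw (θ n) (torusMeasure d) P)
    (hindep : iIndepFun θ P) {ε C : ℝ} (hε : 0 < ε) (hC : 0 < C)
    (h : ∀ m : Fin d → ℕ, (radiiCount r m : ℝ≥0∞) ≤
      ENNReal.ofReal (C * (2 : ℝ) ^ ((1 - ε) * ((∑ i, m i : ℕ) : ℝ)))) :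
    ∀ᵐ ω ∂P, IsCarlesonSequence (HardySpace d) fun n => polarPoint (r n) (θ n ω) := by
  -- the bound only weakens if `ε` is replaced by `min ε 2`; then `q ≥ √2⁻¹`
  set q : ℝ := 2 ^ (-(min ε 2 / 4)) with hq
  have hε' : 0 < min ε 2 := lt_min hε two_pos
  have hq0 : 0 < q := by positivity
  have hq1 : q < 1 := Real.rpow_lt_one_of_one_lt_of_neg one_lt_two (by linarith)
  have hqs : √2⁻¹ ≤ q := by
    rw [Real.sqrt_eq_rpow, Real.inv_rpow zero_le_two, ← Real.rpow_neg zero_le_two]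
    refine Real.rpow_le_rpow_of_exponent_le one_le_two ?_
    linarith [min_le_right ε 2]
  have hq4 : 2 * q ^ 4 = (2 : ℝ) ^ (1 - min ε 2) := by
    rw [hq, ← Real.rpow_natCast, ← Real.rpow_mul zero_le_two, sub_eq_add_neg,
      Real.rpow_add two_pos, Real.rpow_one]
    congr 2
    push_cast
    ring
  have hfin : ∀ m : Fin d → ℕ, {n | ∀ i, (r n i : ℝ) ∈ dyadicRadii (m i)}.Finite := by
    intro m
    rw [← Set.encard_lt_top_iff, ← ENat.toENNReal_lt, ENat.toENNReal_top]
    exact (h m).trans_lt ENNReal.ofReal_lt_top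
  have hcard : ∀ m : Fin d → ℕ,
      ((hfin m).toFinset.card : ℝ) ≤ C * ∏ i, (2 * q ^ 4) ^ m i := by
    intro m
    have h1 := h m
    have hnonneg : 0 ≤ C * (2 : ℝ) ^ ((1 - ε) * ((∑ i, m i : ℕ) : ℝ)) := by positivity
    rw [radiiCount, (hfin m).encard_eq_coe_toFinset_card, ENat.toENNReal_coe,
      ← ENNReal.ofReal_natCast, ENNReal.ofReal_le_ofReal_iff hnonneg] at h1
    refine h1.trans (mul_le_mul_of_nonneg_left ?_ hC.le)
    rw [Finset.prod_pow_eq_pow_sum, hq4, ← Real.rpow_natCast, ← Real.rpow_mul zero_le_two]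
    refine Real.rpow_le_rpow_of_exponent_le one_le_two
      (mul_le_mul_of_nonneg_right ?_ (Nat.cast_nonneg _))
    linarith [min_le_left ε 2]
  choose m hm using fun n i => exists_mem_dyadicRadii (r n i).2.1 (r n i).2.2
  filter_upwards [ae_exists_box_count_le hlaw hindep hq0 hq1 (fun m => (hfin m).toFinset) hcard]
    with ω hω
  obtain ⟨K, hK, hcount⟩ := hω
  refine isCarlesonSequence_of_box_counts hqs hq1 hK hm fun m' l hl c J hJ =>
    hcount m' l hl c J (fun j hj => ?_) fun j hj => (hJ j hj).2
  rw [Set.Finite.mem_toFinset, ← (hJ j hj).1]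
  exact hm j

theorem not_isCarlesonSequence_of_clusters {θ : ℕ → Fin d → UnitAddCircle}
    (h : ∀ j : ℕ, ∃ m b, ∃ J : Finset ℕ,
      (J : Set ℕ) ⊆ {n | ∀ i, (r n i : ℝ) ∈ dyadicRadii (m i)} ∧
      (∀ n ∈ J, θ n ∈ torusBox (gridPoint m b) fun i => 2⁻¹ ^ (m i + 1)) ∧ j ≤ J.card) :
    ¬ IsCarlesonSequence (HardySpace d) fun n => polarPoint (r n) (θ n) := by
  intro hcar
  obtain ⟨B, hB⟩ := hcar.sum_normalizedGram_sq_le fun n => kernelAt_ne_zero _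
  obtain ⟨j, hj⟩ := exists_nat_gt (B / (18⁻¹ ^ d) ^ 2)
  obtain ⟨m, b, J, hJ, hbox, hcard⟩ := h (j + 1)
  obtain ⟨n, hn⟩ : J.Nonempty := Finset.card_pos.1 (by omega)
  have h1 : (J.card : ℝ) * (18⁻¹ ^ d) ^ 2 ≤ B := by
    refine le_trans ?_ (hB n J)
    rw [← nsmul_eq_mul]
    refine Finset.card_nsmul_le_sum _ _ _ fun k hk => ?_
    refine pow_le_pow_left₀ (by positivity)
      (le_normalizedGram_polarPoint (hJ hn) (hJ hk) fun i => ?_) 2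
    have h2 : ‖gridPoint m b i - θ n i‖ ≤ (2 : ℝ)⁻¹ ^ (m i + 1) := hbox n hn i
    have h3 : ‖gridPoint m b i - θ k i‖ ≤ (2 : ℝ)⁻¹ ^ (m i + 1) := hbox k hk i
    have h4 := norm_sub_le (gridPoint m b i - θ k i) (gridPoint m b i - θ n i)
    rw [sub_sub_sub_cancel_left] at h4
    rw [pow_succ] at h2 h3
    linarith
  rw [div_lt_iff₀ (by positivity)] at hj
  have h2 : (j : ℝ) ≤ J.card := by exact_mod_cast (Nat.le_succ j).trans hcard
  have h3 : (0 : ℝ) < (18⁻¹ ^ d) ^ 2 := by positivity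
  nlinarith

end Dichotomy

end PolydiscCarleson

theorem theorem1p1 (d : ℕ) (hd : 0 < d) {Ω : Type*} [MeasurableSpace Ω]
    (P : Measure Ω) [IsProbabilityMeasure P]
    (r : ℕ → Fin d → Set.Ico (0 : ℝ) 1)
    (θ : ℕ → Ω → Fin d → UnitAddCircle)
    (hθ_law : ∀ n, HasLaw (θ n) (PolydiscCarleson.torusMeasure d) P)
    (hθ_indep : iIndepFun θ P) :
    ((∃ ε C : ℝ, 0 < ε ∧ 0 < C ∧ ∀ m : Fin d → ℕ,
        (PolydiscCarleson.radiiCount r m : ℝ≥0∞) ≤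
          ENNReal.ofReal (C * (2 : ℝ) ^ ((1 - ε) * ((∑ i, m i : ℕ) : ℝ)))) →
      ∀ᵐ ω ∂P, PolydiscCarleson.IsCarlesonSequence (PolydiscCarleson.HardySpace d)
        (fun n => PolydiscCarleson.polarPoint (r n) (θ n ω))) ∧
    ((¬ ∃ ε C : ℝ, 0 < ε ∧ 0 < C ∧ ∀ m : Fin d → ℕ,
        (PolydiscCarleson.radiiCount r m : ℝ≥0∞) ≤
          ENNReal.ofReal (C * (2 : ℝ) ^ ((1 - ε) * ((∑ i, m i : ℕ) : ℝ)))) →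
      ∀ᵐ ω ∂P, ¬ PolydiscCarleson.IsCarlesonSequence (PolydiscCarleson.HardySpace d)
        (fun n => PolydiscCarleson.polarPoint (r n) (θ n ω))) := by
  refine ⟨fun ⟨ε, C, hε, hC, h⟩ =>
    PolydiscCarleson.ae_isCarlesonSequence_of_count_le hθ_law hθ_indep hε hC h, fun h => ?_⟩
  filter_upwards [PolydiscCarleson.ae_exists_cluster hθ_law hθ_indep
    (fun m => {n | ∀ i, (r n i : ℝ) ∈ PolydiscCarleson.dyadicRadii (m i)}) h] with ω hω
  exact PolydiscCarleson.not_isCarlesonSequence_of_clusters hω
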